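/- **Model.** Let $G$ be a DAG whose vertices are observed variables $X=\{x_1,\dots,x_p\}$ and finitely many unobserved variables $U$, with $$v_i=\sum_{v_j\to v_i} f^{(i)}_j(v_j)+n_i ,$$ where the functions $f^{(i)}_j:\mathbb R\to\mathbb R$ are measurable and the noises $n_i$ are real and jointly independent. A pair $(x_i,x_j)$, $i\neq j$, is *invisible* if there is an unobserved causal path $x_i\to\cdots\to u\to x_j$ with $u\in U$, or one from $x_j$ to $x_i$, or an unobserved backdoor path $x_i\leftarrow u\leftarrow\cdots\leftarrow v\to\cdots\to w\to x_j$ with $u,w\in U$ (where $v=u$, $v=w$ or $v=u=w$ is allowed, and $v$ may be observed). If the pair is not invisible, it is a *visible edge* $x_j\to x_i$ (resp. $x_i\to x_j$) if $G$ has this edge, and a *visible non-edge* if the two are not adjacent. **Assumptions.** Let $\mathcal G$ be a class of additive functions $G(M)=\sum_{x_m\in M}g_m(x_m)$, $M\subseteq X$, with measurable $g_m$, which for every $i$ contains the function with components $g_m=f^{(i)}_m$ for the observed parents $x_m$ of $x_i$ and $g_m=0$ for all other $m$. 1. (Faithfulness) Every conditional independence among the variables $X\cup U$ is entailed by d-separation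 in $G$. 2. (Function class) For $i\ne j$, $M\subseteq X\setminus\{x_i\}$, $N\subseteq X\setminus\{x_j\}$ and $G_1,G_2\in\mathcal G$: if $x_i-G_1(M)$ and $x_j-G_2(N)$ have terms involving functions of the same noise $n_k$, then they are dependent. Here the structural equation of $x_i$ is inserted, so that $x_i-G_1(M)=\sum_a h_a(v_a)+n_i$ with one term for each variable $v_a$, namely $h_a=f^{(i)}_a-g_a$ if $v_a\in M$ and $h_a=f^{(i)}_a$ otherwise ($f^{(i)}_a=0$ if $v_a$ is not a parent of $x_i$); this has terms involving functions of $n_k$ if $v_k=x_i$, or if $v_k$ equals or is an ancestor of some $v_a$ for which $h_a(v_a)$ is not almost surely constant. 3. (Correct tests) We are given a data matrix, a level $\alpha$, an additive regression procedure and an independence test. Write $e(i,M;j,N)$ for the p-value of the test on the fitted residuals of $x_i$ regressed on $M$ and of $x_j$ regressed on $N$. For all $i\ne j$, $M\subseteq X\setminus\{x_i\}$, $N\subseteq X\setminus\{x_j\}$: $e(i,M;j,N)>\alpha$ if and only if there are $G_1,G_2\in\mathcal G$ such that $x_i-G_1(M)$ and $x_j-G_2(N)$ are independent. **Algorithm.**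 Loops run in any order. CAM-UV with parameter $d$ works as follows. - *Phase 1.* Start with $M_1=\dots=M_p=\emptyset$ and $t=2$. In each pass, go through all $K\subseteq X$ with $|K|=t$ in which no element is a candidate parent of another one ($x_j\in M_i$). Let $x_b\in K$ be a maximizer of $\min_{x_j\in K\setminus\{x_b\}}e(b,M_b\cup K\setminus\{x_b\};j,M_j)$, and add $K\setminus\{x_b\}$ to $M_b$ if this minimum exceeds $\alpha$. After a pass with a change, reset $t$ to $2$; after one without, increase $t$ by $1$. Stop when $t>d$. - *Phase 2.* Go through all pairs with $x_j\in M_i$, and remove $x_j$ from $M_i$ if $e(i,M_i\setminus\{x_j\};j,M_j)>\alpha$. - *Marking.* Set $A=0$, then $A(i,j)=1$ for $x_j\in M_i$. For every pair $i<j$ with neither $x_j\in M_i$ nor $x_i\in M_j$ and with $e(i,M_i;j,M_j)\le\alpha$, set $A(i,j)=A(j,i)=\mathrm{NaN}$. CAM-UV-X starts with this $A$ and calls checkVisible$(i,j)$ for all $i<j$ with $A(i,j)=A(j,i)=\mathrm{NaN}$. Let $Q$ be the set of all $x_k$, $k\ne i,j$, such that $A(i,k)$ or $A(j,k)$ is $1$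 or $\mathrm{NaN}$. Run through all $M,N\subseteq Q$. If $e(i,M;j,N)>\alpha$, set $A(i,j)=A(j,i)=0$ and return. Otherwise, if $e(i,M\cup\{x_j\};j,N)>\alpha$, record that $x_i$ is not a parent of $x_j$; if $e(i,M;j,N\cup\{x_i\})>\alpha$, record that $x_j$ is not a parent of $x_i$; once both are recorded, set $A(i,j)=A(j,i)=0$ and return. If the loop ends with only the first recorded, set $A(i,j)=1$, $A(j,i)=0$; if with only the second, set $A(j,i)=1$, $A(i,j)=0$. After these calls, CAM-UV-X *identifies* $x_j\to x_i$ as a visible edge if $A(i,j)=1$, $A(j,i)=0$, $(x_i,x_j)$ as a visible non-edge if $A(i,j)=A(j,i)=0$, and as an invisible pair if $A(i,j)=A(j,i)=\mathrm{NaN}$. The remaining procedures of CAM-UV-X (checkOnPath, checkCI and checkParentInvi, the second of which uses an arbitrary conditional independence test) then record parent-child and ancestor relations in pairs identified as invisible. **Theorem.** Under these assumptions CAM-UV-X is sound and complete in identifying visible edges, visible non-edges and invisible pairs: for all $i\neq j$ it identifies $x_j\to x_i$ as a visible edge if and only if it is one, $(x_i,x_j)$ as a visible non-edge if and only if it is one,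 and $(x_i,x_j)$ as an invisible pair if and only if it is one. Moreover, the remaining procedures do not change the entries of $A$ at visible pairs. -/

import Mathlib

open MeasureTheory ProbabilityTheory

namespace CAMUV

/-! ## The causal model -/

/-- An acyclic causal additive model with `p` observed variables (`Sum.inl i`) and a finite set `U`
of unobserved variables (`Sum.inr u`) on a probability space `(Ω, μ)`.
`Edge a b` means `a → b`. `f i j` is the effect of `j` on `i`; it is the zero function when
`j` is not a direct cause of `i`. -/
structure Model (p : ℕ) (U : Type*) [Fintype U] {Ω : Type*} [MeasurableSpace Ω]
    (μ : Measure Ω) where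
  /-- the edges of the causal graph -/
  Edge : Fin p ⊕ U → Fin p ⊕ U → Prop
  acyclic : ∀ a, ¬ Relation.TransGen Edge a a
  /-- the causal functions -/
  f : Fin p ⊕ U → Fin p ⊕ U → ℝ → ℝ
  measurable_f : ∀ i j, Measurable (f i j)
  f_eq_zero : ∀ i j, ¬ Edge j i → f i j = 0
  /-- the external noises -/
  noise : Fin p ⊕ U → Ω → ℝ
  measurable_noise : ∀ i, Measurable (noise i)
  indep_noise : iIndepFun noise μ
  /-- the variables -/
  v : Fin p ⊕ U → Ω → ℝ
  measurable_v : ∀ i, Measurable (v i)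
  structural : ∀ i ω, v i ω = ∑ j, f i j (v j ω) + noise i ω

section Graph

variable {V : Type*}

/-- `Anc E a b`: there is a directed path (possibly of length zero) from `a` to `b`. -/
def Anc (E : V → V → Prop) : V → V → Prop := Relation.ReflTransGen E

/-- `l` is an active path given `C`: a path (no repeated vertex, edges of either orientation) on
which every non-collider lies outside `C` and every collider has a descendant in `C`
(a vertex is a descendant of itself). -/
def ActivePath (E : V → V → Prop) (C : Set V) (l : List V) : Prop :=
  l.Nodup ∧ l.IsChain (fun x y => E x y ∨ E y x) ∧
    ∀ x y z, [x, y, z] <:+: l →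
      (E x y ∧ E z y → ∃ c ∈ C, Anc E y c) ∧ (¬ (E x y ∧ E z y) → y ∉ C)

/-- `a` and `b` are d-separated by `C`. -/
def DSep (E : V → V → Prop) (C : Set V) (a b : V) : Prop :=
  ¬ ∃ l : List V, l.head? = some a ∧ l.getLast? = some b ∧ ActivePath E C l

end Graph

namespace Model

variable {p : ℕ} {U : Type*} [Fintype U] {Ω : Type*} [MeasurableSpace Ω] {μ : Measure Ω}

/-- The σ-algebra generated by the variables in `C`. -/
abbrev sigma (𝓜 : Model p U μ) (C : Set (Fin p ⊕ U)) : MeasurableSpace Ω :=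
  ⨆ c ∈ C, MeasurableSpace.comap (𝓜.v c) inferInstance

theorem sigma_le (𝓜 : Model p U μ) (C : Set (Fin p ⊕ U)) :
    𝓜.sigma C ≤ (inferInstance : MeasurableSpace Ω) :=
  iSup₂_le fun c _ => (𝓜.measurable_v c).comap_le

/-- Causal faithfulness: every conditional independence among the (observed and unobserved)
variables is entailed by d-separation. It is enough to state this for pairs of single variables,
since sets of variables are d-separated as soon as all pairs of their elements are. -/
def Faithful [StandardBorelSpace Ω] [IsFiniteMeasure μ] (𝓜 : Model p U μ) : Prop :=
  ∀ (a b : Fin p ⊕ U) (C : Set (Fin p ⊕ U)), a ≠ b → a ∉ C → b ∉ C →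
    CondIndepFun (𝓜.sigma C) (𝓜.sigma_le C) (𝓜.v a) (𝓜.v b) μ → DSep 𝓜.Edge C a b

/-! ### Visible and invisible pairs -/

/-- There is an unobserved causal path `x_i → ⋯ → u → x_j` with `u` unobserved. -/
def UCP (𝓜 : Model p U μ) (i j : Fin p) : Prop :=
  ∃ u : U, Anc 𝓜.Edge (.inl i) (.inr u) ∧ 𝓜.Edge (.inr u) (.inl j)

/-- There is an unobserved backdoor path `x_i ← u ← ⋯ ← a → ⋯ → w → x_j` with `u`, `w` unobserved
(`a = u`, `a = w` or `a = u = w` allowed, `a` observed or not).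
The two directed halves are not required to be disjoint: if they meet, the last common vertex can
replace `a`, and if one of them runs through `x_i` or `x_j`, there is an unobserved causal path
between the two. So nothing changes for the disjunction with `UCP` that is used below. -/
def UBP (𝓜 : Model p U μ) (i j : Fin p) : Prop :=
  ∃ (a : Fin p ⊕ U) (u w : U), Anc 𝓜.Edge a (.inr u) ∧ 𝓜.Edge (.inr u) (.inl i) ∧
    Anc 𝓜.Edge a (.inr w) ∧ 𝓜.Edge (.inr w) (.inl j)

/-- `(x_i, x_j)` is an invisible pair. -/
def Invisible (𝓜 : Model p U μ) (i j : Fin p) : Prop :=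
  𝓜.UBP i j ∨ 𝓜.UCP i j ∨ 𝓜.UCP j i

/-- `x_j → x_i` is a visible edge: `x_j` is a visible parent of `x_i`. -/
def VisibleEdge (𝓜 : Model p U μ) (j i : Fin p) : Prop :=
  𝓜.Edge (.inl j) (.inl i) ∧ ¬ 𝓜.Invisible i j

/-- `(x_i, x_j)` is a visible non-edge. -/
def VisibleNonEdge (𝓜 : Model p U μ) (i j : Fin p) : Prop :=
  ¬ 𝓜.Edge (.inl i) (.inl j) ∧ ¬ 𝓜.Edge (.inl j) (.inl i) ∧ ¬ 𝓜.Invisible i j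

/-! ### Residuals of additive regressions

A generalized additive function `G` is given by its component functions: `G m : ℝ → ℝ` is applied to
the variable `x_m`, and `G(M) = ∑_{m ∈ M} G m (x_m)`. -/

/-- The residual `x_i - G(M)`. -/
def residual (𝓜 : Model p U μ) (i : Fin p) (M : Finset (Fin p)) (G : Fin p → ℝ → ℝ) (ω : Ω) : ℝ :=
  𝓜.v (.inl i) ω - ∑ m ∈ M, G m (𝓜.v (.inl m) ω)

/-- After inserting the structural equation of `x_i`, the residual is
`x_i - G(M) = ∑_a residualTerm a (v_a) + n_i`, with one term for each variable `a`. -/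
def residualTerm (𝓜 : Model p U μ) (i : Fin p) (M : Finset (Fin p)) (G : Fin p → ℝ → ℝ) :
    Fin p ⊕ U → ℝ → ℝ
  | .inl m => fun x => 𝓜.f (.inl i) (.inl m) x - if m ∈ M then G m x else 0
  | .inr u => 𝓜.f (.inl i) (.inr u)

theorem residual_eq (𝓜 : Model p U μ) (i : Fin p) (M : Finset (Fin p)) (G : Fin p → ℝ → ℝ)
    (ω : Ω) : 𝓜.residual i M G ω =
      ∑ a, 𝓜.residualTerm i M G a (𝓜.v a ω) + 𝓜.noise (.inl i) ω := by
  rw [residual, 𝓜.structural]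
  simp only [Fintype.sum_sum_type, residualTerm, Finset.sum_sub_distrib, Finset.sum_ite_mem,
    Finset.univ_inter]
  ring

/-- The residual `x_i - G(M)` has terms involving functions of the external effect `n_k`: either
`n_k` is the noise of `x_i`, or, for some variable `a`, the term in `v_a` does not cancel to
a constant and `n_k` enters `v_a`, i.e. `k` is `a` or an ancestor of `a`. -/
def InvolvesNoise (𝓜 : Model p U μ) (i : Fin p) (M : Finset (Fin p)) (G : Fin p → ℝ → ℝ)
    (k : Fin p ⊕ U) : Prop :=
  k = .inl i ∨
    ∃ a, (¬ ∃ c : ℝ, ∀ᵐ ω ∂μ, 𝓜.residualTerm i M G a (𝓜.v a ω) = c) ∧ Anc 𝓜.Edge k a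

/-- The assumption on the function class `𝒢`: two residuals that have terms involving functions of
the same external effect are dependent. -/
def NoCancellation (𝓜 : Model p U μ) (𝒢 : Set (Fin p → ℝ → ℝ)) : Prop :=
  ∀ i j : Fin p, i ≠ j → ∀ M N : Finset (Fin p), i ∉ M → j ∉ N → ∀ G₁ ∈ 𝒢, ∀ G₂ ∈ 𝒢,
    (∃ k, 𝓜.InvolvesNoise i M G₁ k ∧ 𝓜.InvolvesNoise j N G₂ k) →
      ¬ IndepFun (𝓜.residual i M G₁) (𝓜.residual j N G₂) μ

end Model

/-! ## The algorithms -/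

/-- A data matrix with `n` samples of the `p` observed variables, a regression procedure
(`fit i M` are the component functions of the additive regression of `x_i` on `M` that is fitted
to the data), an independence test and a conditional independence test (both return p-values).
No property of these procedures is built in. -/
structure Tests (n p : ℕ) where
  /-- the data matrix -/
  data : Fin n → Fin p → ℝ
  /-- the fitted generalized additive regression functions -/
  fit : Fin p → Finset (Fin p) → Fin p → ℝ → ℝ
  /-- the p-value of the independence test -/
  pHSIC : (Fin n → ℝ) → (Fin n → ℝ) → ℝ
  /-- `pCI x y z` is the p-value of the test of independence of `x` and `y` given `z` -/
  pCI : (Fin n → ℝ) → (Fin n → ℝ) → (Fin n → ℝ) → ℝ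

namespace Tests

variable {n p : ℕ}

/-- The empirical residual of the fitted regression of `x_i` on `M`. -/
def empResidual (T : Tests n p) (i : Fin p) (M : Finset (Fin p)) (s : Fin n) : ℝ :=
  T.data s i - ∑ m ∈ M, T.fit i M m (T.data s m)

/-- The p-value of the independence of `x_i - G_i(M)` and `x_j - G_j(N)` for the fitted `G_i`, `G_j`. -/
def pval (T : Tests n p) (i : Fin p) (M : Finset (Fin p)) (j : Fin p) (N : Finset (Fin p)) : ℝ :=
  T.pHSIC (T.empResidual i M) (T.empResidual j N)

/-- The p-value of the conditional independence of `x_k` and `x_j` given `x_i`. -/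
def pvalCI (T : Tests n p) (k j i : Fin p) : ℝ :=
  T.pCI (fun s => T.data s k) (fun s => T.data s j) (fun s => T.data s i)

/-- Regression and independence test at level `α` decide correctly whether two residuals can be made
independent by functions of the class `𝒢`. -/
def Correct {U : Type*} [Fintype U] {Ω : Type*} [MeasurableSpace Ω] {μ : Measure Ω}
    (T : Tests n p) (α : ℝ) (𝓜 : Model p U μ) (𝒢 : Set (Fin p → ℝ → ℝ)) : Prop :=
  ∀ i j : Fin p, i ≠ j → ∀ M N : Finset (Fin p), i ∉ M → j ∉ N →
    ((∃ G₁ ∈ 𝒢, ∃ G₂ ∈ 𝒢, IndepFun (𝓜.residual i M G₁) (𝓜.residual j N G₂) μ) ↔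
      α < T.pval i M j N)

end Tests

/-- The order in which the loops of the algorithms run through the variables and through the subsets
of a set of variables. -/
structure LoopOrder (p : ℕ) where
  /-- an enumeration of the variables -/
  vars : List (Fin p)
  mem_vars : ∀ i, i ∈ vars
  /-- an enumeration of the subsets of a set -/
  subsets : Finset (Fin p) → List (Finset (Fin p))
  mem_subsets : ∀ Q M, M ∈ subsets Q ↔ M ⊆ Q

/-- All pairs of variables. -/
def LoopOrder.pairs {p : ℕ} (o : LoopOrder p) : List (Fin p × Fin p) := o.vars ×ˢ o.vars

/-- All pairs `i < j` of variables. -/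
def LoopOrder.pairsLT {p : ℕ} (o : LoopOrder p) : List (Fin p × Fin p) :=
  o.pairs.filter fun q => q.1 < q.2

/-- The values of the entries of the adjacency matrix: `A i j` is `one` if `x_j` is inferred to be
a parent of `x_i`, `zero` if it is inferred not to be, and `nan` if this is left open. -/
inductive Entry
  | zero
  | one
  | nan
  deriving DecidableEq

/-- Adjacency matrices. -/
abbrev AdjMatrix (p : ℕ) := Fin p → Fin p → Entry

/-- Set the entry `A(i,j)` to `x`. -/
def AdjMatrix.set {p : ℕ} (A : AdjMatrix p) (i j : Fin p) (x : Entry) : AdjMatrix p :=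
  fun a b => if a = i ∧ b = j then x else A a b

noncomputable section

open scoped Classical

variable {n p : ℕ} (T : Tests n p) (α : ℝ) (o : LoopOrder p)

/-! ### CAM-UV -/

/-- Candidate parent sets `M_1, …, M_p`. -/
abbrev Candidates (p : ℕ) := Fin p → Finset (Fin p)

/-- The score of `x_i` as a sink of `K`: the least p-value of the independence of
`x_i - G_1(M_i ∪ K \ {x_i})` and `x_j - G_2(M_j)`, over `j ∈ K \ {i}`. -/
def sinkScore (M : Candidates p) (K : Finset (Fin p)) (i : Fin p) : WithTop ℝ :=
  (K.erase i).inf fun j => (T.pval i (M i ∪ K.erase i) j (M j) : WithTop ℝ)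

/-- Phase 1, one set `K`: unless `K` already contains a variable and one of its candidate parents,
search the best sink `b` of `K`, and add `K \ {b}` to its candidate parents if its score
exceeds the level. -/
def phase1Set (M : Candidates p) (K : Finset (Fin p)) : Candidates p :=
  if ∀ i ∈ K, ∀ j ∈ K, j ∉ M i then
    match (o.vars.filter (· ∈ K)).argmax (sinkScore T M K) with
    | none => M
    | some b =>
      if (α : WithTop ℝ) < sinkScore T M K b then
        Function.update M b (M b ∪ K.erase b)
      else M
  else M

/-- Phase 1, one pass through all sets `K` of `t` variables. -/
def phase1Pass (t : ℕ) (M : Candidates p) : Candidates p :=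
  ((o.subsets Finset.univ).filter (fun K => K.card = t)).foldl (phase1Set T α o) M

/-- Phase 1, one round: a pass with the current `t`; then `t` is increased if nothing has
changed, and reset to `2` otherwise. Nothing happens once `t` exceeds `d`. -/
def phase1Round (d : ℕ) (s : ℕ × Candidates p) : ℕ × Candidates p :=
  if d < s.1 then s
  else
    let M' := phase1Pass T α o s.1 s.2
    if M' = s.2 then (s.1 + 1, s.2) else (2, M')

/-- Phase 1: repeat from `t = 2` and empty candidate sets until `t > d`. At most `p * p` rounds
change the candidates, and at most `d` rounds lie between two changes, so that this number of
rounds is enough. -/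
def phase1 (d : ℕ) : Candidates p :=
  ((phase1Round T α o d)^[(p * p + 1) * (d + 1)] (2, fun _ => ∅)).2

/-- Phase 2, one pair: remove `x_j` from `M_i` if it is not needed for independence. -/
def phase2Pair (M : Candidates p) (q : Fin p × Fin p) : Candidates p :=
  if q.2 ∈ M q.1 ∧ α < T.pval q.1 ((M q.1).erase q.2) q.2 (M q.2) then
    Function.update M q.1 ((M q.1).erase q.2)
  else M

/-- The final candidate parent sets: phase 1 followed by phase 2. -/
def candidates (d : ℕ) : Candidates p :=
  o.pairs.foldl (phase2Pair T α) (phase1 T α o d)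

/-- Last step of CAM-UV, one pair `i < j`: candidate parents become edges, and a pair without an
edge whose residuals are dependent is marked as invisible. -/
def markPair (M : Candidates p) (A : AdjMatrix p) (q : Fin p × Fin p) : AdjMatrix p :=
  if q.2 ∈ M q.1 then A.set q.1 q.2 .one
  else if q.1 ∈ M q.2 then A.set q.2 q.1 .one
  else if T.pval q.1 (M q.1) q.2 (M q.2) ≤ α then (A.set q.1 q.2 .nan).set q.2 q.1 .nan
  else A

/-- The CAM-UV algorithm with maximal set size `d` and level `α`. -/
def camUV (d : ℕ) : AdjMatrix p :=
  o.pairsLT.foldl (markPair T α (candidates T α o d)) (fun _ _ => .zero)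

/-! ### checkVisible -/

/-- The set `Q` searched by `checkVisible(i,j)`: the other variables whose relation to `x_i` or
`x_j` is open or that are parents of `x_i` or `x_j`. -/
def searchSet (A : AdjMatrix p) (i j : Fin p) : Finset (Fin p) :=
  {k | (A j k = .nan ∨ A i k = .nan ∨ A i k = .one ∨ A j k = .one) ∧ k ≠ i ∧ k ≠ j}

/-- The loop of `checkVisible(i,j)` over the pairs `(M, N)` that remain to be searched, with
the current values of the flags `iNotParent` and `jNotParent`, and the final assignments. -/
def checkVisibleLoop (i j : Fin p) (A : AdjMatrix p) :
    List (Finset (Fin p) × Finset (Fin p)) → Prop → Prop → AdjMatrix p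
  | [], iNotParent, jNotParent =>
    let A := if iNotParent then (A.set i j .one).set j i .zero else A
    if jNotParent then (A.set j i .one).set i j .zero else A
  | (M, N) :: rest, iNotParent, jNotParent =>
    if α < T.pval i M j N then (A.set i j .zero).set j i .zero
    else
      let iNotParent := iNotParent ∨ α < T.pval i (insert j M) j N
      let jNotParent := jNotParent ∨ α < T.pval i M j (insert i N)
      if iNotParent ∧ jNotParent then (A.set i j .zero).set j i .zero
      else checkVisibleLoop i j A rest iNotParent jNotParent

/-- `checkVisible(i,j)`. -/
def checkVisible (A : AdjMatrix p) (q : Fin p × Fin p) : AdjMatrix p :=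
  let S := o.subsets (searchSet A q.1 q.2)
  checkVisibleLoop T α q.1 q.2 A (S ×ˢ S) False False

/-- The adjacency matrix after CAM-UV and the loop of `checkVisible` over all pairs that CAM-UV has
marked as invisible. -/
def visibility (d : ℕ) : AdjMatrix p :=
  let A := camUV T α o d
  (o.pairsLT.filter fun q => A q.1 q.2 = .nan ∧ A q.2 q.1 = .nan).foldl (checkVisible T α o) A

/-! ### The remaining procedures of CAM-UV-X, which refine the information on invisible pairs -/

/-- `M i`: variables identified as ancestors of `x_i`; `H i`: variables identified as
non-ancestors of `x_i`; `C k`: unordered pairs `[i,j]` such that `x_k` is identified as a parent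
of `x_i` or of `x_j`. -/
structure State (p : ℕ) where
  /-- adjacency matrix -/
  A : AdjMatrix p
  /-- identified ancestors -/
  M : Fin p → Finset (Fin p)
  /-- identified non-ancestors -/
  H : Fin p → Finset (Fin p)
  /-- pairs of which `x_k` is a parent of one -/
  C : Fin p → Finset (Sym2 (Fin p))

/-- Insert `x` in the set with index `i`. -/
def insertAt {β : Type*} (F : Fin p → Finset β) (i : Fin p) (x : β) : Fin p → Finset β :=
  Function.update F i (insert x (F i))

/-- `checkOnPath(i,j)`, one variable `x_k`. -/
def checkOnPathStep (i j : Fin p) (s : State p) (k : Fin p) : State p :=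
  if k ≠ i ∧ k ≠ j ∧ (s.A i k = .nan ∨ s.A j k = .nan) ∧
      (∀ M N : Finset (Fin p), i ∉ M → k ∉ M → j ∉ N → k ∉ N → ¬ α < T.pval i M j N) then
    let s := { s with C := insertAt s.C k s(i, j) }
    if s.A i j = .one then
      { s with M := insertAt s.M i k, H := insertAt s.H k i, A := s.A.set k i .zero }
    else if s.A j i = .one then
      { s with M := insertAt s.M j k, H := insertAt s.H k j, A := s.A.set k j .zero }
    else s
  else s

/-- `checkOnPath(i,j)`. -/
def checkOnPath (s : State p) (q : Fin p × Fin p) : State p :=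
  o.vars.foldl (checkOnPathStep T α q.1 q.2) s

/-- `x_k` has been identified as an ancestor of `x_i`. -/
def State.KnownAncestor (s : State p) (k i : Fin p) : Prop :=
  Relation.TransGen (fun a b => a ∈ s.M b ∨ s.A b a = .one) k i

/-- `checkCI(i,j)`, one variable `x_k`. -/
def checkCIStep (i j : Fin p) (s : State p) (k : Fin p) : State p :=
  if s.KnownAncestor k i ∧ α < T.pvalCI k j i then
    { s with H := insertAt s.H i j, A := s.A.set i j .zero, M := insertAt s.M j i }
  else s

/-- `checkCI(i,j)`. -/
def checkCI (s : State p) (q : Fin p × Fin p) : State p :=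
  o.vars.foldl (checkCIStep T α q.1 q.2) s

/-- `checkParentInvi`, one ordered pair `[i,j]` and one `k`. -/
def checkParentInviStep (k : Fin p) (s : State p) (q : Fin p × Fin p) : State p :=
  if s(q.1, q.2) ∈ s.C k ∧ s.A q.2 k = .nan ∧ (k ∈ s.H q.1 ∨ s.A q.1 k = .zero) then
    { s with A := (s.A.set q.2 k .one).set k q.2 .zero }
  else s

/-- `checkParentInvi`: passes are repeated until there is no change. Every pass with a change
removes an entry `nan`, so that `p * p + 1` passes are enough. -/
def checkParentInvi (s : State p) : State p :=
  (fun s : State p => o.vars.foldl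
    (fun s k => o.pairs.foldl (checkParentInviStep k) s) s)^[p * p + 1] s

/-! ### CAM-UV-X -/

/-- The output of CAM-UV-X: the final adjacency matrix and sets, together with the adjacency
matrix `vis` after the last call of `checkVisible`, by which the pairs are identified as visible
edges, visible non-edges and invisible pairs. (In the final matrix, entries of pairs that are
identified as invisible may have been overwritten by what has been found out about their
parent-child relationship.) -/
structure Output (p : ℕ) extends State p where
  /-- adjacency matrix by which pairs are identified as visible or invisible -/
  vis : AdjMatrix p

/-- The algorithm CAM-UV-X. -/
def camUVX (d : ℕ) : Output p :=
  let A := visibility T α o d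
  let s₀ : State p := ⟨A, fun _ => ∅, fun _ => ∅, fun _ => ∅⟩
  let I := o.pairsLT.filter fun q => A q.1 q.2 ≠ .nan ∧ A q.2 q.1 ≠ .nan
  let s₁ := I.foldl (checkOnPath T α o) s₀
  let S := o.pairs.filter fun q => s₁.A q.1 q.2 = .nan ∧ s₁.A q.2 q.1 = .nan
  let s₂ := S.foldl (checkCI T α o) s₁
  { checkParentInvi o s₂ with vis := A }

/-- CAM-UV-X identifies `x_j → x_i` as a visible edge. -/
def Output.IdentifiesEdge (out : Output p) (j i : Fin p) : Prop :=
  out.vis i j = .one ∧ out.vis j i = .zero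

/-- CAM-UV-X identifies `(x_i, x_j)` as a visible non-edge. -/
def Output.IdentifiesNonEdge (out : Output p) (i j : Fin p) : Prop :=
  out.vis i j = .zero ∧ out.vis j i = .zero

/-- CAM-UV-X identifies `(x_i, x_j)` as an invisible pair. -/
def Output.IdentifiesInvisible (out : Output p) (i j : Fin p) : Prop :=
  out.vis i j = .nan ∧ out.vis j i = .nan

end

end CAMUV

/-!
Everything reduces to a comparison of sets of noises. For `x_i` and a regression set `M`, let the
noise support consist of the noise of `x_i` and of those of all ancestors of parents of `x_i`
outside `M`. Every residual of `x_i` on `M` involves all of these noises: a term in a parent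
outside `M` is the causal function itself, and it is not almost surely constant, since otherwise
the variable would be independent of this parent given its other parents, against faithfulness
(`Model.Faithful.not_ae_const`). Regression with the true causal functions involves no other
noises. As common noises make residuals dependent and residuals with disjoint supports are
functions of disjoint sets of independent noises, a p-value exceeds the level if and only if the
two supports are disjoint (`Tests.Correct.lt_pval_iff`).

Supports shrink as the regression sets grow. For an invisible pair they always meet; for a visible
pair they are disjoint once all observed parents are regressed out; and a parent that is left out
of the regression set always produces a common noise (`Model.not_invisible_of_disjoint`,
`Model.disjoint_of_not_invisible`, `Model.not_edge_of_disjoint`). From these facts: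

* In CAM-UV the residual of a variable stays independent of those of its candidate parents, the
  candidate relation stays asymmetric, and phase 2 removes exactly the candidates that are not
  parents (`valid_candidates`). So all entries of CAM-UV other than `nan` are correct, whatever the
  maximal set size `d` and the choice of sinks are (`soundAt_camUV`).
* Therefore the search sets of `checkVisible` contain all observed parents, and its loop finds the
  true entries (`visibility_eq_trueEntry`).
* `checkOnPath` writes `zero` at `(k, l)` only if `x_k` is an ancestor of `x_l`, where `zero` is
  the true entry of a visible pair, and the other procedures write only at invisible pairs
  (`trueOnVisible_camUVX`).
-/

namespace CAMUV

/-! ### Conditional independence from an independent noise -/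

/-- If `m₁` is independent of `m' ⊔ m₂`, then conditioning on `m'` takes out the factor `𝟙_s` of
`s ∈ m'` and averages the factor `𝟙_t` of `t ∈ m₁`. -/
theorem condExp_inter_inter_ae_eq {Ω : Type*} {m' m₁ m₂ mΩ : MeasurableSpace Ω}
    {μ : Measure Ω} [IsProbabilityMeasure μ] (hm' : m' ≤ mΩ) (hm₁ : m₁ ≤ mΩ) (hm₂ : m₂ ≤ mΩ)
    (h : Indep m₁ (m' ⊔ m₂) μ) {s t u : Set Ω} (hs : MeasurableSet[m'] s)
    (ht : MeasurableSet[m₁] t) (hu : MeasurableSet[m₂] u) :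
    μ⟦s ∩ t ∩ u | m'⟧ =ᵐ[μ] s.indicator (fun ω => μ.real t * (μ⟦u | m'⟧) ω) := by
  have hs0 := hm' s hs
  have ht0 := hm₁ t ht
  have hu0 := hm₂ u hu
  have hint : Integrable (fun ω => μ.real t * (μ⟦u | m'⟧) ω) μ := integrable_condExp.const_mul _
  refine (ae_eq_condExp_of_forall_setIntegral_eq hm' ?_ ?_ ?_ ?_).symm
  · exact (integrable_const _).indicator ((hs0.inter ht0).inter hu0)
  · exact fun D hD _ => (hint.indicator hs0).integrableOn
  · intro D hD _
    have hD0 := hm' D hD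
    rw [setIntegral_indicator hs0, integral_const_mul,
      setIntegral_condExp hm' ((integrable_const _).indicator hu0) (hD.inter hs),
      integral_indicator_const _ hu0, integral_indicator_const _ ((hs0.inter ht0).inter hu0)]
    rw [measureReal_restrict_apply hu0, measureReal_restrict_apply ((hs0.inter ht0).inter hu0),
      smul_eq_mul, smul_eq_mul, mul_one, mul_one]
    have hind := (Indep_iff _ _ μ).1 h t (u ∩ (D ∩ s)) ht
      ((le_sup_right (a := m') _ hu).inter
        ((le_sup_left (b := m₂) _ hD).inter (le_sup_left (b := m₂) _ hs)))
    rw [show s ∩ t ∩ u ∩ D = t ∩ (u ∩ (D ∩ s)) by ext; simp; tauto]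
    simp [measureReal_def, hind, ENNReal.toReal_mul]
  · exact ((stronglyMeasurable_condExp.const_mul _).indicator hs).aestronglyMeasurable

/-- If `m₁` is independent of `m' ⊔ m₂`, then `m' ⊔ m₁` and `m₂` are independent given `m'`. -/
theorem condIndep_sup_of_indep {Ω : Type*} {m' m₁ m₂ mΩ : MeasurableSpace Ω}
    [StandardBorelSpace Ω] {μ : Measure Ω} [IsProbabilityMeasure μ] (hm' : m' ≤ mΩ)
    (hm₁ : m₁ ≤ mΩ) (hm₂ : m₂ ≤ mΩ) (h : Indep m₁ (m' ⊔ m₂) μ) :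
    CondIndep m' (m' ⊔ m₁) m₂ hm' μ := by
  let P : Set (Set Ω) := Set.image2 (· ∩ ·) {s | MeasurableSet[m'] s} {t | MeasurableSet[m₁] t}
  have hP : ∀ s ∈ P, MeasurableSet[mΩ] s := by
    rintro _ ⟨s, hs, t, ht, rfl⟩
    exact (hm' s hs).inter (hm₁ t ht)
  refine CondIndepSets.condIndep (p1 := P) (p2 := {u | MeasurableSet[m₂] u})
    (sup_le hm' hm₁) hm₂ ?_ (@MeasurableSpace.isPiSystem_measurableSet Ω m₂) ?_
    (@MeasurableSpace.generateFrom_measurableSet Ω m₂).symm ?_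
  · rintro _ ⟨s, hs, t, ht, rfl⟩ _ ⟨s', hs', t', ht', rfl⟩ _
    exact ⟨s ∩ s', MeasurableSet.inter hs hs', t ∩ t', MeasurableSet.inter ht ht',
      Set.inter_inter_inter_comm ..⟩
  · refine le_antisymm (sup_le ?_ ?_) (MeasurableSpace.generateFrom_le ?_)
    · exact fun s hs => MeasurableSpace.measurableSet_generateFrom
        ⟨s, hs, Set.univ, MeasurableSet.univ, Set.inter_univ s⟩
    · exact fun t ht => MeasurableSpace.measurableSet_generateFrom
        ⟨Set.univ, MeasurableSet.univ, t, ht, Set.univ_inter t⟩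
    · rintro _ ⟨s, hs, t, ht, rfl⟩
      exact MeasurableSet.inter (le_sup_left (b := m₁) _ hs) (le_sup_right (a := m') _ ht)
  · refine (condIndepSets_iff _ _ _ _ hP (fun u hu => hm₂ u hu) μ).2 ?_
    rintro _ u ⟨s, hs, t, ht, rfl⟩ hu
    have h1 := condExp_inter_inter_ae_eq hm' hm₁ hm₂ h hs ht hu
    have h2 := condExp_inter_inter_ae_eq hm' hm₁ hm₂ h hs ht (@MeasurableSet.univ Ω m₂)
    rw [Set.inter_univ] at h2
    have h3 : μ⟦(Set.univ : Set Ω) | m'⟧ = fun _ => (1 : ℝ) := by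
      rw [Set.indicator_univ]; exact condExp_const hm' _
    filter_upwards [h1, h2] with ω h1 h2
    rw [Pi.mul_apply, h1, h2, h3]
    by_cases hω : ω ∈ s <;> simp [hω]

/-- If `X` is the sum of an `m'`-measurable function and a noise that is independent of `m'` and `Y`
jointly, then `X` and `Y` are independent given `m'`. -/
theorem condIndepFun_of_ae_eq_add {Ω : Type*} {m' mΩ : MeasurableSpace Ω}
    [StandardBorelSpace Ω] {μ : Measure Ω} [IsProbabilityMeasure μ] (hm' : m' ≤ mΩ)
    {X Y g ε : Ω → ℝ} (hX : Measurable X) (hY : Measurable Y) (hε : Measurable ε)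
    (hg : Measurable[m'] g) (hXg : X =ᵐ[μ] fun ω => g ω + ε ω)
    (h : Indep (MeasurableSpace.comap ε inferInstance)
      (m' ⊔ MeasurableSpace.comap Y inferInstance) μ) :
    CondIndepFun m' hm' X Y μ := by
  have hci := condIndep_sup_of_indep hm' hε.comap_le hY.comap_le h
  have hgε : Measurable[m' ⊔ MeasurableSpace.comap ε inferInstance] fun ω => g ω + ε ω :=
    Measurable.add (hg.mono le_sup_left le_rfl) ((comap_measurable ε).mono le_sup_right le_rfl)
  have hZ : CondIndepFun m' hm' (fun ω => g ω + ε ω) Y μ :=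
    (condIndepFun_iff_condIndep ..).2
      (condIndep_of_condIndep_of_le_left hci hgε.comap_le)
  have hZm : Measurable fun ω => g ω + ε ω := (hg.mono hm' le_rfl).add hε
  rw [condIndepFun_iff_condExp_inter_preimage_eq_mul hX hY]
  rw [condIndepFun_iff_condExp_inter_preimage_eq_mul hZm hY] at hZ
  intro s t hs ht
  have e1 : (X ⁻¹' s : Set Ω) =ᵐ[μ] (fun ω => g ω + ε ω) ⁻¹' s := by
    filter_upwards [hXg] with ω hω
    exact propext (by change X ω ∈ s ↔ g ω + ε ω ∈ s; rw [hω])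
  have e2 := e1.inter (ae_eq_refl (Y ⁻¹' t))
  refine (condExp_congr_ae (indicator_ae_eq_of_ae_eq_set e2)).trans ((hZ s t hs ht).trans ?_)
  filter_upwards [condExp_congr_ae (m := m')
    (indicator_ae_eq_of_ae_eq_set (f := fun _ => (1 : ℝ)) e1)]
    with ω hω
  rw [hω]

/-! ### Variables as functions of the noises -/

namespace Model

variable {p : ℕ} {U : Type*} [Fintype U] {Ω : Type*} [MeasurableSpace Ω] {μ : Measure Ω}
  (𝓜 : Model p U μ)

theorem wellFounded_edge : WellFounded 𝓜.Edge := by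
  have : IsTrans (Fin p ⊕ U) (Relation.TransGen 𝓜.Edge) := ⟨fun _ _ _ => Relation.TransGen.trans⟩
  have : Std.Irrefl (Relation.TransGen 𝓜.Edge) := ⟨𝓜.acyclic⟩
  exact Subrelation.wf Relation.TransGen.single
    (Finite.wellFounded_of_trans_of_irrefl (Relation.TransGen 𝓜.Edge))

theorem not_anc_of_edge {a b : Fin p ⊕ U} (h : 𝓜.Edge a b) : ¬ Anc 𝓜.Edge b a :=
  fun h' => 𝓜.acyclic b (Relation.TransGen.tail' h' h)

/-- The σ-algebra generated by the noises with index in `S`. -/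
abbrev noiseSigma (S : Set (Fin p ⊕ U)) : MeasurableSpace Ω :=
  ⨆ k ∈ S, MeasurableSpace.comap (𝓜.noise k) inferInstance

theorem noiseSigma_mono {S T : Set (Fin p ⊕ U)} (h : S ⊆ T) : 𝓜.noiseSigma S ≤ 𝓜.noiseSigma T :=
  biSup_mono fun _ hk => h hk

theorem measurable_noise_noiseSigma {S : Set (Fin p ⊕ U)} {k : Fin p ⊕ U} (hk : k ∈ S) :
    Measurable[𝓜.noiseSigma S] (𝓜.noise k) :=
  (comap_measurable (𝓜.noise k)).mono
    (le_iSup₂_of_le (f := fun k (_ : k ∈ S) => MeasurableSpace.comap (𝓜.noise k) inferInstance)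
      k hk le_rfl) le_rfl

theorem indep_noiseSigma {S T : Set (Fin p ⊕ U)} (h : Disjoint S T) :
    Indep (𝓜.noiseSigma S) (𝓜.noiseSigma T) μ :=
  indep_iSup_of_disjoint (fun k => (𝓜.measurable_noise k).comap_le) 𝓜.indep_noise.iIndep h

theorem measurable_v_noiseSigma (a : Fin p ⊕ U) :
    Measurable[𝓜.noiseSigma {k | Anc 𝓜.Edge k a}] (𝓜.v a) := by
  induction a using 𝓜.wellFounded_edge.induction with
  | _ a ih =>
    rw [funext (𝓜.structural a)]
    refine Measurable.add (Finset.measurable_fun_sum _ fun j _ => ?_)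
      (𝓜.measurable_noise_noiseSigma Relation.ReflTransGen.refl)
    by_cases hj : 𝓜.Edge j a
    · exact (𝓜.measurable_f a j).comp
        ((ih j hj).mono (𝓜.noiseSigma_mono fun k hk => Relation.ReflTransGen.tail hk hj) le_rfl)
    · rw [𝓜.f_eq_zero a j hj]
      exact measurable_const

/-- Under faithfulness the effect of a parent is never almost surely constant: otherwise a variable
would be independent of this parent given its other parents, although adjacent variables are never
d-separated. -/
theorem Faithful.not_ae_const [StandardBorelSpace Ω] [IsProbabilityMeasure μ] {𝓜 : Model p U μ}
    (hF : 𝓜.Faithful) {a b : Fin p ⊕ U} (hab : 𝓜.Edge b a) :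
    ¬ ∃ c : ℝ, ∀ᵐ ω ∂μ, 𝓜.f a b (𝓜.v b ω) = c := by
  classical
  rintro ⟨c, hc⟩
  have hne : a ≠ b := by
    rintro rfl
    exact 𝓜.not_anc_of_edge hab Relation.ReflTransGen.refl
  let C : Set (Fin p ⊕ U) := {j | 𝓜.Edge j a ∧ j ≠ b}
  have hsep : DSep 𝓜.Edge C a b := by
    refine hF a b C hne (fun h => 𝓜.not_anc_of_edge h.1 Relation.ReflTransGen.refl)
      (fun h => h.2 rfl) ?_
    refine condIndepFun_of_ae_eq_add
      (g := fun ω => (∑ j ∈ Finset.univ.erase b, 𝓜.f a j (𝓜.v j ω)) + c)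
      (ε := 𝓜.noise a) _ (𝓜.measurable_v a) (𝓜.measurable_v b) (𝓜.measurable_noise a) ?_ ?_ ?_
    · refine Measurable.add (Finset.measurable_fun_sum _ fun j hj => ?_) measurable_const
      by_cases hja : 𝓜.Edge j a
      · have hjC : j ∈ C := ⟨hja, Finset.ne_of_mem_erase hj⟩
        exact (𝓜.measurable_f a j).comp ((comap_measurable (𝓜.v j)).mono
          (le_iSup₂_of_le (f := fun k (_ : k ∈ C) => MeasurableSpace.comap (𝓜.v k) inferInstance)
            j hjC le_rfl) le_rfl)
      · rw [𝓜.f_eq_zero a j hja]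
        exact measurable_const
    · filter_upwards [hc] with ω hω
      rw [𝓜.structural a ω, ← Finset.sum_erase_add _ _ (Finset.mem_univ b), hω]
    · have hpar : ∀ j, 𝓜.Edge j a →
          MeasurableSpace.comap (𝓜.v j) inferInstance ≤ 𝓜.noiseSigma {a}ᶜ := by
        intro j hj
        have hsub : {k | Anc 𝓜.Edge k j} ⊆ ({a}ᶜ : Set (Fin p ⊕ U)) := by
          rintro k hk rfl
          exact 𝓜.not_anc_of_edge hj hk
        exact (𝓜.measurable_v_noiseSigma j).comap_le.trans (𝓜.noiseSigma_mono hsub)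
      refine indep_of_indep_of_le_left (indep_of_indep_of_le_right
        (𝓜.indep_noiseSigma (disjoint_compl_right (a := ({a} : Set (Fin p ⊕ U)))))
        (sup_le (iSup₂_le fun j hj => hpar j hj.1) (hpar b hab)))
        (𝓜.measurable_noise_noiseSigma (Set.mem_singleton a)).comap_le
  -- The edge itself is an active path: it has no inner vertices.
  refine hsep ⟨[a, b], rfl, rfl, by simpa using hne, by simpa using Or.inr hab, ?_⟩
  intro x y z h
  simpa using h.length_le

/-! ### Noise supports of residuals -/

/-- The smallest set of noises that a residual of `x_i` on `M` can involve: the noise of `x_i` and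
those of all ancestors of the parents of `x_i` that are not in `M`. -/
def noiseSupport (i : Fin p) (M : Finset (Fin p)) : Set (Fin p ⊕ U) :=
  {k | k = .inl i ∨ ∃ a, 𝓜.Edge a (.inl i) ∧ (∀ m ∈ M, a ≠ .inl m) ∧ Anc 𝓜.Edge k a}

/-- No choice of regression functions removes a noise of the support from the residual: the terms in
parents outside `M` are the causal functions themselves, and these are not constant. -/
theorem Faithful.involvesNoise [StandardBorelSpace Ω] [IsProbabilityMeasure μ] {𝓜 : Model p U μ}
    (hF : 𝓜.Faithful) {i : Fin p} {M : Finset (Fin p)} (G : Fin p → ℝ → ℝ) {k : Fin p ⊕ U}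
    (hk : k ∈ 𝓜.noiseSupport i M) : 𝓜.InvolvesNoise i M G k := by
  rcases hk with rfl | ⟨a, ha, haM, hka⟩
  · exact Or.inl rfl
  · refine Or.inr ⟨a, ?_, hka⟩
    have hf := hF.not_ae_const ha
    cases a with
    | inl m =>
      have hm : m ∉ M := fun hm => haM m hm rfl
      simpa [residualTerm, hm] using hf
    | inr u => exact hf

/-- Regression with the true causal functions leaves only the noises of the support: the terms in
`M` cancel. -/
theorem measurable_residual_true (i : Fin p) (M : Finset (Fin p)) :
    Measurable[𝓜.noiseSigma (𝓜.noiseSupport i M)]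
      (𝓜.residual i M fun m => 𝓜.f (.inl i) (.inl m)) := by
  rw [funext (𝓜.residual_eq i M _)]
  refine Measurable.add (Finset.measurable_fun_sum _ fun a _ => ?_)
    (𝓜.measurable_noise_noiseSigma (Or.inl rfl))
  by_cases ha : 𝓜.Edge a (.inl i) ∧ ∀ m ∈ M, a ≠ .inl m
  · have hterm : 𝓜.residualTerm i M (fun m => 𝓜.f (.inl i) (.inl m)) a = 𝓜.f (.inl i) a := by
      cases a with
      | inl m =>
        have hm : m ∉ M := fun hm => ha.2 m hm rfl
        simp [residualTerm, hm]
      | inr u => rfl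
    rw [hterm]
    exact (𝓜.measurable_f _ _).comp ((𝓜.measurable_v_noiseSigma a).mono
      (𝓜.noiseSigma_mono fun k hk => Or.inr ⟨a, ha.1, ha.2, hk⟩) le_rfl)
  · have hterm : 𝓜.residualTerm i M (fun m => 𝓜.f (.inl i) (.inl m)) a = 0 := by
      rw [not_and_or] at ha
      rcases ha with ha | ha
      · have h0 := 𝓜.f_eq_zero _ _ ha
        cases a <;> simp [residualTerm, h0]; rfl
      · push Not at ha
        obtain ⟨m, hm, rfl⟩ := ha
        simp [residualTerm, hm]; rfl
    rw [hterm]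
    exact measurable_const

end Model

/-- Correct tests compare noise supports. The true regression functions attain the smallest
supports, and residuals with disjoint supports are functions of disjoint sets of independent noises;
conversely, a common noise cannot cancel. -/
theorem Tests.Correct.lt_pval_iff {n p : ℕ} {U Ω : Type*} [Fintype U] [MeasurableSpace Ω]
    [StandardBorelSpace Ω] {μ : Measure Ω} [IsProbabilityMeasure μ] {𝓜 : Model p U μ}
    {𝒢 : Set (Fin p → ℝ → ℝ)} (h_true : ∀ i : Fin p, (fun m => 𝓜.f (Sum.inl i) (Sum.inl m)) ∈ 𝒢)
    (h_faithful : 𝓜.Faithful) (h_class : 𝓜.NoCancellation 𝒢) {T : Tests n p} {α : ℝ}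
    (hT : T.Correct α 𝓜 𝒢) {i j : Fin p} (hij : i ≠ j) {M N : Finset (Fin p)} (hM : i ∉ M)
    (hN : j ∉ N) :
    α < T.pval i M j N ↔ Disjoint (𝓜.noiseSupport i M) (𝓜.noiseSupport j N) := by
  rw [← hT i j hij M N hM hN]
  constructor
  · rintro ⟨G₁, hG₁, G₂, hG₂, hind⟩
    refine Set.disjoint_left.2 fun k hk hk' => ?_
    exact h_class i j hij M N hM hN G₁ hG₁ G₂ hG₂
      ⟨k, h_faithful.involvesNoise G₁ hk, h_faithful.involvesNoise G₂ hk'⟩ hind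
  · intro h
    refine ⟨_, h_true i, _, h_true j, (IndepFun_iff_Indep ..).2 ?_⟩
    exact indep_of_indep_of_le_left (indep_of_indep_of_le_right (𝓜.indep_noiseSigma h)
      (𝓜.measurable_residual_true j N).comap_le) (𝓜.measurable_residual_true i M).comap_le

/-! ### Noise supports and visibility -/

namespace Model

variable {p : ℕ} {U : Type*} [Fintype U] {Ω : Type*} [MeasurableSpace Ω] {μ : Measure Ω}
  {𝓜 : Model p U μ} {i j : Fin p} {M N : Finset (Fin p)}

theorem noiseSupport_anti {M' : Finset (Fin p)} (h : M ⊆ M') :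
    𝓜.noiseSupport i M' ⊆ 𝓜.noiseSupport i M := by
  rintro k (rfl | ⟨a, ha, haM, hka⟩)
  · exact Or.inl rfl
  · exact Or.inr ⟨a, ha, fun m hm => haM m (h hm), hka⟩

theorem self_mem_noiseSupport : .inl i ∈ 𝓜.noiseSupport i M := Or.inl rfl

theorem noiseSupport_erase (h : ¬ 𝓜.Edge (.inl j) (.inl i)) :
    𝓜.noiseSupport i (M.erase j) = 𝓜.noiseSupport i M := by
  refine Set.Subset.antisymm ?_ (noiseSupport_anti (M.erase_subset j))
  rintro k (rfl | ⟨a, ha, haM, hka⟩)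
  · exact Or.inl rfl
  · refine Or.inr ⟨a, ha, ?_, hka⟩
    rintro m hm rfl
    exact haM m (Finset.mem_erase.2 ⟨fun hmj => h (hmj ▸ ha), hm⟩) rfl

theorem mem_noiseSupport_of_unobserved {k : Fin p ⊕ U} {u : U} (hk : Anc 𝓜.Edge k (.inr u))
    (hu : 𝓜.Edge (.inr u) (.inl i)) : k ∈ 𝓜.noiseSupport i M :=
  Or.inr ⟨.inr u, hu, fun _ _ => Sum.inr_ne_inl, hk⟩

theorem not_edge_of_disjoint (h : Disjoint (𝓜.noiseSupport i M) (𝓜.noiseSupport j N))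
    (hi : i ∉ N) : ¬ 𝓜.Edge (.inl i) (.inl j) := fun he =>
  Set.disjoint_left.1 h self_mem_noiseSupport
    (Or.inr ⟨.inl i, he, fun _ hm heq => hi (Sum.inl_injective heq ▸ hm),
      Relation.ReflTransGen.refl⟩)

theorem not_invisible_of_disjoint (h : Disjoint (𝓜.noiseSupport i M) (𝓜.noiseSupport j N)) :
    ¬ 𝓜.Invisible i j := by
  rw [Set.disjoint_left] at h
  rintro (⟨a, u, w, hu, hui, hw, hwj⟩ | ⟨u, hu, huj⟩ | ⟨u, hu, hui⟩)
  · exact h (mem_noiseSupport_of_unobserved hu hui) (mem_noiseSupport_of_unobserved hw hwj)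
  · exact h self_mem_noiseSupport (mem_noiseSupport_of_unobserved hu huj)
  · exact h (mem_noiseSupport_of_unobserved hu hui) self_mem_noiseSupport

/-- Once all observed parents are regressed out, only noises that arrive through unobserved parents
are left beside the own noise, and a common one of these is what makes a pair invisible. -/
theorem disjoint_of_not_invisible (hij : i ≠ j) (h : ¬ 𝓜.Invisible i j)
    (hM : ∀ m, 𝓜.Edge (.inl m) (.inl i) → m ∈ M) (hN : ∀ m, 𝓜.Edge (.inl m) (.inl j) → m ∈ N) :
    Disjoint (𝓜.noiseSupport i M) (𝓜.noiseSupport j N) := by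
  have unobs : ∀ {l : Fin p} {L : Finset (Fin p)} {k : Fin p ⊕ U},
      (∀ m, 𝓜.Edge (.inl m) (.inl l) → m ∈ L) → k ∈ 𝓜.noiseSupport l L →
      k = .inl l ∨ ∃ u : U, Anc 𝓜.Edge k (.inr u) ∧ 𝓜.Edge (.inr u) (.inl l) := by
    rintro l L k hL (rfl | ⟨a, ha, haL, hka⟩)
    · exact Or.inl rfl
    · cases a with
      | inl m => exact absurd rfl (haL m (hL m ha))
      | inr u => exact Or.inr ⟨u, hka, ha⟩
  refine Set.disjoint_left.2 fun k hk hk' => h ?_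
  rcases unobs hM hk with rfl | ⟨u, hu, hui⟩ <;> rcases unobs hN hk' with hkj | ⟨w, hw, hwj⟩
  · exact absurd (Sum.inl_injective hkj) hij
  · exact Or.inr (Or.inl ⟨w, hw, hwj⟩)
  · subst hkj
    exact Or.inr (Or.inr ⟨u, hu, hui⟩)
  · exact Or.inl ⟨k, u, w, hu, hui, hw, hwj⟩

theorem Invisible.symm (h : 𝓜.Invisible i j) : 𝓜.Invisible j i := by
  rcases h with ⟨a, u, w, hu, hui, hw, hwj⟩ | h | h
  · exact Or.inl ⟨a, w, u, hw, hwj, hu, hui⟩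
  · exact Or.inr (Or.inr h)
  · exact Or.inr (Or.inl h)

open scoped Classical in
/-- The entry that `A i j` ought to have: `nan` at invisible pairs, and otherwise `one` or `zero`
according to whether `x_j` is a parent of `x_i`. -/
noncomputable def trueEntry (𝓜 : Model p U μ) (i j : Fin p) : Entry :=
  if 𝓜.Invisible i j then .nan else if 𝓜.Edge (.inl j) (.inl i) then .one else .zero

theorem trueEntry_eq_nan : 𝓜.trueEntry i j = .nan ↔ 𝓜.Invisible i j := by
  unfold trueEntry; split_ifs <;> simp_all

theorem trueEntry_eq_one :
    𝓜.trueEntry i j = .one ↔ 𝓜.Edge (.inl j) (.inl i) ∧ ¬ 𝓜.Invisible i j := by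
  unfold trueEntry; split_ifs <;> simp_all

theorem trueEntry_eq_zero :
    𝓜.trueEntry i j = .zero ↔ ¬ 𝓜.Edge (.inl j) (.inl i) ∧ ¬ 𝓜.Invisible i j := by
  unfold trueEntry; split_ifs <;> simp_all

end Model

/-- The p-values at level `α` decide whether noise supports are disjoint. This is all that the
analysis of the algorithms uses about the distribution and the tests. -/
def Tests.DecidesSupports {n p : ℕ} {U Ω : Type*} [Fintype U] [MeasurableSpace Ω] {μ : Measure Ω}
    (T : Tests n p) (α : ℝ) (𝓜 : Model p U μ) : Prop :=
  ∀ ⦃i j : Fin p⦄, i ≠ j → ∀ ⦃M N : Finset (Fin p)⦄, i ∉ M → j ∉ N →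
    (α < T.pval i M j N ↔ Disjoint (𝓜.noiseSupport i M) (𝓜.noiseSupport j N))

/-! ### Candidate parents -/

/-- An invariant `P` of a loop, and a property `R q` that is established when `q` is processed and
is not destroyed later. -/
theorem foldl_invariant {β ι : Type*} {f : β → ι → β} {P : β → Prop} {R : ι → β → Prop}
    {l : List ι} (step : ∀ s, P s → ∀ q ∈ l, P (f s q) ∧ R q (f s q))
    (persist : ∀ s, P s → ∀ q ∈ l, ∀ q', R q' s → R q' (f s q)) :
    ∀ s, P s → P (l.foldl f s) ∧ ∀ q ∈ l, R q (l.foldl f s) := by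
  suffices H : ∀ l' : List ι, l' ⊆ l → ∀ s, P s → P (l'.foldl f s) ∧
      ∀ q, q ∈ l' ∨ R q s → R q (l'.foldl f s) from
    fun s hs => ⟨(H l (List.Subset.refl l) s hs).1,
      fun q hq => (H l (List.Subset.refl l) s hs).2 q (Or.inl hq)⟩
  intro l'
  induction l' with
  | nil => exact fun _ s hs => ⟨hs, fun q hq => by simpa using hq⟩
  | cons a t ih =>
    intro hl s hs
    have ha : a ∈ l := hl List.mem_cons_self
    obtain ⟨h1, h2⟩ := ih (fun x hx => hl (List.mem_cons_of_mem a hx)) (f s a) (step s hs a ha).1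
    refine ⟨h1, fun q hq => h2 q ?_⟩
    rcases hq with hq | hq
    · rcases List.mem_cons.1 hq with rfl | hq
      · exact Or.inr (step s hs q ha).2
      · exact Or.inl hq
    · exact Or.inr (persist s hs a ha q hq)

theorem LoopOrder.mem_pairs {p : ℕ} (o : LoopOrder p) (q : Fin p × Fin p) : q ∈ o.pairs :=
  List.pair_mem_product.2 ⟨o.mem_vars q.1, o.mem_vars q.2⟩

theorem LoopOrder.mem_pairsLT {p : ℕ} (o : LoopOrder p) (q : Fin p × Fin p) :
    q ∈ o.pairsLT ↔ q.1 < q.2 := by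
  simp [LoopOrder.pairsLT, o.mem_pairs]

section Candidates

variable {n p : ℕ} {U Ω : Type*} [Fintype U] [MeasurableSpace Ω] {μ : Measure Ω}
  {𝓜 : Model p U μ} {T : Tests n p} {α : ℝ} {o : LoopOrder p}

/-- The invariant of the search for candidate parents: the candidate relation is irreflexive and
asymmetric, and the residual of a variable is independent of those of its candidate parents. -/
def Candidates.Valid (𝓜 : Model p U μ) (M : Candidates p) : Prop :=
  (∀ i, i ∉ M i) ∧ ∀ i j, j ∈ M i →
    i ∉ M j ∧ Disjoint (𝓜.noiseSupport i (M i)) (𝓜.noiseSupport j (M j))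

/-- Enlarging candidate sets only shrinks noise supports, so that independence persists; asymmetry
persists because `K` contains no variable together with one of its candidate parents. -/
theorem Candidates.Valid.phase1Set (hT : T.DecidesSupports α 𝓜) {M : Candidates p}
    (hM : M.Valid 𝓜) (K : Finset (Fin p)) : (phase1Set T α o M K).Valid 𝓜 := by
  classical
  unfold CAMUV.phase1Set
  split_ifs with hK
  swap
  · exact hM
  split
  · exact hM
  rename_i b hb
  split_ifs with hscore
  swap
  · exact hM
  have hbK : b ∈ K := by simpa using List.of_mem_filter (List.argmax_mem hb)
  have hnew : ∀ j ∈ K.erase b,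
      Disjoint (𝓜.noiseSupport b (M b ∪ K.erase b)) (𝓜.noiseSupport j (M j)) := by
    intro j hj
    have h := (Finset.lt_inf_iff (WithTop.coe_lt_top α)).1 hscore j hj
    refine (hT (Finset.ne_of_mem_erase hj).symm ?_ (hM.1 j)).1 (WithTop.coe_lt_coe.1 h)
    simp [hM.1 b]
  have hold : ∀ i, 𝓜.noiseSupport i (Function.update M b (M b ∪ K.erase b) i) ⊆
      𝓜.noiseSupport i (M i) := by
    intro i
    by_cases hi : i = b
    · subst hi
      rw [Function.update_self]
      exact Model.noiseSupport_anti Finset.subset_union_left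
    · rw [Function.update_of_ne hi]
  constructor
  · intro i
    by_cases hi : i = b
    · subst hi
      simp [hM.1 i]
    · rw [Function.update_of_ne hi]
      exact hM.1 i
  · intro i j hj
    by_cases hjold : j ∈ M i
    · refine ⟨?_, (hM.2 i j hjold).2.mono (hold i) (hold j)⟩
      by_cases hjb : j = b
      · subst hjb
        rw [Function.update_self, Finset.mem_union, not_or]
        exact ⟨(hM.2 i j hjold).1,
          fun hi => hK i (Finset.mem_of_mem_erase hi) j hbK hjold⟩
      · rw [Function.update_of_ne hjb]
        exact (hM.2 i j hjold).1
    · have hi : i = b := by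
        by_contra hi
        rw [Function.update_of_ne hi] at hj
        exact hjold hj
      subst hi
      rw [Function.update_self, Finset.mem_union, or_iff_right hjold] at hj
      rw [Function.update_self, Function.update_of_ne (Finset.ne_of_mem_erase hj)]
      exact ⟨hK j (Finset.mem_of_mem_erase hj) i hbK, hnew j hj⟩

theorem valid_phase1 (hT : T.DecidesSupports α 𝓜) (d : ℕ) : (phase1 T α o d).Valid 𝓜 := by
  classical
  have hpass : ∀ (t : ℕ) (M : Candidates p), M.Valid 𝓜 → (phase1Pass T α o t M).Valid 𝓜 :=
    fun t M hM => (foldl_invariant (P := fun M : Candidates p => M.Valid 𝓜)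
      (R := fun _ _ => True) (fun s hs K _ => ⟨hs.phase1Set hT K, trivial⟩)
      (fun _ _ _ _ _ _ => trivial) M hM).1
  have hround : ∀ s : ℕ × Candidates p, s.2.Valid 𝓜 → (phase1Round T α o d s).2.Valid 𝓜 := by
    intro s hs
    unfold phase1Round
    dsimp only
    split_ifs
    · exact hs
    · exact hs
    · exact hpass _ _ hs
  unfold phase1
  generalize (p * p + 1) * (d + 1) = m
  induction m with
  | zero => exact ⟨fun i => Finset.notMem_empty i, fun i j hj => absurd hj (Finset.notMem_empty j)⟩
  | succ m ih =>
    rw [Function.iterate_succ_apply']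
    exact hround _ ih

theorem phase2Pair_subset (M : Candidates p) (q : Fin p × Fin p) (i : Fin p) :
    phase2Pair T α M q i ⊆ M i := by
  unfold phase2Pair
  split_ifs
  · by_cases hi : i = q.1
    · subst hi
      rw [Function.update_self]
      exact Finset.erase_subset _ _
    · rw [Function.update_of_ne hi]
  · exact Finset.Subset.refl _

/-- A parent is never removed in phase 2, since its noise would enter the residual. So phase 2
does not change noise supports, and every candidate that is not a parent is removed. -/
theorem Candidates.Valid.phase2Pair (hT : T.DecidesSupports α 𝓜) {M : Candidates p}
    (hM : M.Valid 𝓜) (q : Fin p × Fin p) :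
    (phase2Pair T α M q).Valid 𝓜 ∧
      (q.2 ∈ phase2Pair T α M q q.1 → 𝓜.Edge (.inl q.2) (.inl q.1)) := by
  obtain ⟨i, j⟩ := q
  have hsub := phase2Pair_subset (T := T) (α := α) M (i, j)
  dsimp only
  have hpval : j ∈ M i → (α < T.pval i ((M i).erase j) j (M j) ↔
      Disjoint (𝓜.noiseSupport i ((M i).erase j)) (𝓜.noiseSupport j (M j))) := fun hj =>
    hT (fun hij => hM.1 i (by rwa [← hij] at hj)) (fun h => hM.1 i (Finset.mem_of_mem_erase h))
      (hM.1 j)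
  have hsupp : ∀ k, 𝓜.noiseSupport k (CAMUV.phase2Pair T α M (i, j) k) =
      𝓜.noiseSupport k (M k) := by
    intro k
    unfold CAMUV.phase2Pair
    split_ifs with h
    · by_cases hk : k = i
      · subst hk
        rw [Function.update_self]
        exact Model.noiseSupport_erase
          (Model.not_edge_of_disjoint ((hpval h.1).1 h.2).symm (Finset.notMem_erase _ _))
      · rw [Function.update_of_ne hk]
    · rfl
  refine ⟨⟨fun k hk => hM.1 k (hsub k hk), fun k l hl => ?_⟩, fun hj => ?_⟩
  · rw [hsupp, hsupp]
    exact ⟨fun hk => (hM.2 k l (hsub k hl)).1 (hsub l hk), (hM.2 k l (hsub k hl)).2⟩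
  · by_contra hedge
    have hjM := hsub i hj
    have hlt : α < T.pval i ((M i).erase j) j (M j) := by
      rw [hpval hjM, Model.noiseSupport_erase hedge]
      exact (hM.2 i j hjM).2
    rw [CAMUV.phase2Pair, if_pos ⟨hjM, hlt⟩, Function.update_self] at hj
    exact Finset.notMem_erase _ _ hj

/-- The final candidate parents are parents, since phase 2 runs through all pairs. -/
theorem valid_candidates (hT : T.DecidesSupports α 𝓜) (d : ℕ) :
    (candidates T α o d).Valid 𝓜 ∧
      ∀ i j, j ∈ candidates T α o d i → 𝓜.Edge (.inl j) (.inl i) := by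
  have h := foldl_invariant (f := phase2Pair T α) (l := o.pairs)
    (P := fun M : Candidates p => M.Valid 𝓜)
    (R := fun q M => q.2 ∈ M q.1 → 𝓜.Edge (.inl q.2) (.inl q.1))
    (fun M hM q _ => hM.phase2Pair hT q)
    (fun M _ q _ q' hq' hmem => hq' (phase2Pair_subset M q _ hmem)) _ (valid_phase1 (o := o) hT d)
  exact ⟨h.1, fun i j => h.2 (i, j) (o.mem_pairs _)⟩

end Candidates

/-! ### Marking and `checkVisible` -/

section Visibility

variable {n p : ℕ} {U Ω : Type*} [Fintype U] [MeasurableSpace Ω] {μ : Measure Ω}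
  {𝓜 : Model p U μ} {T : Tests n p} {α : ℝ} {o : LoopOrder p}

theorem AdjMatrix.set_self (A : AdjMatrix p) (i j : Fin p) (x : Entry) : A.set i j x i j = x := by
  simp [AdjMatrix.set]

theorem AdjMatrix.set_of_ne (A : AdjMatrix p) {i j a b : Fin p} (x : Entry)
    (h : ¬ (a = i ∧ b = j)) : A.set i j x a b = A a b := by
  simp [AdjMatrix.set, h]

open scoped Classical in
/-- The entry at `(a, b)` with which the marking step of CAM-UV ends for the candidate sets `M`. -/
noncomputable def markedEntry (𝓜 : Model p U μ) (M : Candidates p) (a b : Fin p) : Entry :=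
  if b ∈ M a then .one else if a ∈ M b then .zero
  else if Disjoint (𝓜.noiseSupport a (M a)) (𝓜.noiseSupport b (M b)) then .zero else .nan

/-- The entries at `(a, b)` and `(b, a)` are those of `B`. -/
def AgreeAt (B A : AdjMatrix p) (a b : Fin p) : Prop := A a b = B a b ∧ A b a = B b a

theorem markPair_of_ne (M : Candidates p) (A : AdjMatrix p) {q : Fin p × Fin p} {a b : Fin p}
    (h : ¬ (a = q.1 ∧ b = q.2)) (h' : ¬ (a = q.2 ∧ b = q.1)) :
    markPair T α M A q a b = A a b := by
  unfold markPair
  split_ifs <;> simp [AdjMatrix.set_of_ne, h, h']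

/-- The second alternative is the initial state of the entries. -/
theorem agreeAt_markPair (hT : T.DecidesSupports α 𝓜) {M : Candidates p} (hM : M.Valid 𝓜)
    {A : AdjMatrix p} {q : Fin p × Fin p} (hq : q.1 ≠ q.2)
    (hA : AgreeAt (markedEntry 𝓜 M) A q.1 q.2 ∨ AgreeAt (fun _ _ => .zero) A q.1 q.2) :
    AgreeAt (markedEntry 𝓜 M) (markPair T α M A q) q.1 q.2 := by
  obtain ⟨i, j⟩ := q
  dsimp only at hq hA ⊢
  have hpval := hT hq (hM.1 i) (hM.1 j)
  unfold AgreeAt markedEntry at hA ⊢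
  unfold markPair
  dsimp only
  by_cases h1 : j ∈ M i
  · have h2 := (hM.2 i j h1).1
    rcases hA with hA | hA <;> simp_all [AdjMatrix.set, hq.symm]
  by_cases h2 : i ∈ M j
  · rcases hA with hA | hA <;> simp_all [AdjMatrix.set, hq.symm]
  by_cases h3 : α < T.pval i (M i) j (M j)
  · have hd := hpval.1 h3
    rcases hA with hA | hA <;> simpa [h1, h2, not_le.2 h3, hd, hd.symm] using hA
  · have hd := mt hpval.2 h3
    have hd' : ¬ Disjoint (𝓜.noiseSupport j (M j)) (𝓜.noiseSupport i (M i)) := fun h => hd h.symm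
    simp [h1, h2, not_lt.1 h3, hd, hd', AdjMatrix.set]

theorem camUV_eq (hT : T.DecidesSupports α 𝓜) (d : ℕ) {a b : Fin p} (hab : a ≠ b) :
    camUV T α o d a b = markedEntry 𝓜 (candidates T α o d) a b := by
  have hM := (valid_candidates (o := o) hT d).1
  set M := candidates T α o d
  have h := foldl_invariant (f := markPair T α M) (l := o.pairsLT)
    (P := fun A => ∀ a b, a < b →
      AgreeAt (markedEntry 𝓜 M) A a b ∨ AgreeAt (fun _ _ => .zero) A a b)
    (R := fun q A => q.1 < q.2 → AgreeAt (markedEntry 𝓜 M) A q.1 q.2) ?_ ?_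
    (fun _ _ => .zero) (fun _ _ _ => Or.inr ⟨rfl, rfl⟩)
  · have hlt : ∀ {a b : Fin p}, a < b → AgreeAt (markedEntry 𝓜 M) (camUV T α o d) a b :=
      fun {a b} hab => h.2 (a, b) ((o.mem_pairsLT _).2 hab) hab
    rcases lt_or_gt_of_ne hab with hab | hab
    · exact (hlt hab).1
    · exact (hlt hab).2
  all_goals
    intro A hA q hq
    have hq' := (o.mem_pairsLT q).1 hq
    have hnew := agreeAt_markPair hT hM hq'.ne (hA q.1 q.2 hq')
    have hkeep : ∀ a b, a < b → (a, b) ≠ q →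
        markPair T α M A q a b = A a b ∧ markPair T α M A q b a = A b a := by
      intro a b hab hne
      have h1 : ¬ (a = q.1 ∧ b = q.2) := fun h => hne (Prod.ext h.1 h.2)
      have h2 : ¬ (a = q.2 ∧ b = q.1) := by
        rintro ⟨rfl, rfl⟩
        exact lt_asymm hab hq'
      exact ⟨markPair_of_ne M A h1 h2,
        markPair_of_ne M A (fun h => h2 h.symm) (fun h => h1 h.symm)⟩
  · refine ⟨fun a b hab => ?_, fun _ => hnew⟩
    by_cases hne : (a, b) = q
    · subst hne
      exact Or.inl hnew
    · unfold AgreeAt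
      rw [(hkeep a b hab hne).1, (hkeep a b hab hne).2]
      exact hA a b hab
  · intro r hr hlt
    by_cases hne : r = q
    · subst hne
      exact hnew
    · unfold AgreeAt
      rw [(hkeep r.1 r.2 hlt hne).1, (hkeep r.1 r.2 hlt hne).2]
      exact hr hlt

/-- At `a ≠ b` the entries are the true ones, or both are still open. -/
def SoundAt (𝓜 : Model p U μ) (A : AdjMatrix p) (a b : Fin p) : Prop :=
  AgreeAt 𝓜.trueEntry A a b ∨ (A a b = .nan ∧ A b a = .nan)

theorem agreeAt_trueEntry_of_disjoint {A : AdjMatrix p} {i j : Fin p} {M N : Finset (Fin p)}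
    (h : Disjoint (𝓜.noiseSupport i M) (𝓜.noiseSupport j N)) (hi : i ∉ N) (hj : j ∉ M)
    (h1 : A i j = .zero) (h2 : A j i = .zero) : AgreeAt 𝓜.trueEntry A i j := by
  have hinv := Model.not_invisible_of_disjoint h
  constructor
  · rw [h1, eq_comm, Model.trueEntry_eq_zero]
    exact ⟨Model.not_edge_of_disjoint h.symm hj, hinv⟩
  · rw [h2, eq_comm, Model.trueEntry_eq_zero]
    exact ⟨Model.not_edge_of_disjoint h hi, fun h' => hinv h'.symm⟩

theorem soundAt_camUV (hT : T.DecidesSupports α 𝓜) (d : ℕ) {a b : Fin p} (hab : a ≠ b) :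
    SoundAt 𝓜 (camUV T α o d) a b := by
  obtain ⟨hM, hedge⟩ := valid_candidates (o := o) hT d
  have key : ∀ {a b : Fin p}, a ≠ b → b ∈ candidates T α o d a →
      AgreeAt 𝓜.trueEntry (camUV T α o d) a b := by
    intro a b hab h
    have hinv := Model.not_invisible_of_disjoint (hM.2 a b h).2
    have he := hedge a b h
    rw [AgreeAt, camUV_eq hT d hab, camUV_eq hT d hab.symm]
    constructor
    · rw [Model.trueEntry_eq_one.2 ⟨he, hinv⟩, markedEntry, if_pos h]
    · rw [Model.trueEntry_eq_zero.2 ⟨fun he' => 𝓜.not_anc_of_edge he (.single he'),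
        fun h' => hinv h'.symm⟩, markedEntry, if_neg (hM.2 a b h).1, if_pos h]
  by_cases h1 : b ∈ candidates T α o d a
  · exact Or.inl (key hab h1)
  by_cases h2 : a ∈ candidates T α o d b
  · exact Or.inl (key hab.symm h2).symm
  by_cases h3 : Disjoint (𝓜.noiseSupport a (candidates T α o d a))
      (𝓜.noiseSupport b (candidates T α o d b))
  · refine Or.inl (agreeAt_trueEntry_of_disjoint h3 h2 h1 ?_ ?_)
    · rw [camUV_eq hT d hab, markedEntry, if_neg h1, if_neg h2, if_pos h3]
    · rw [camUV_eq hT d hab.symm, markedEntry, if_neg h2, if_neg h1, if_pos h3.symm]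
  · refine Or.inr ⟨?_, ?_⟩
    · rw [camUV_eq hT d hab, markedEntry, if_neg h1, if_neg h2, if_neg h3]
    · rw [camUV_eq hT d hab.symm, markedEntry, if_neg h2, if_neg h1,
        if_neg fun h => h3 h.symm]

theorem checkVisibleLoop_of_ne {i j a b : Fin p} (h : ¬ (a = i ∧ b = j)) (h' : ¬ (a = j ∧ b = i))
    (A : AdjMatrix p) (l : List (Finset (Fin p) × Finset (Fin p))) (fi fj : Prop) :
    checkVisibleLoop T α i j A l fi fj a b = A a b := by
  induction l generalizing fi fj with
  | nil =>
    simp only [checkVisibleLoop]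
    split_ifs <;> simp [AdjMatrix.set_of_ne, h, h']
  | cons q l ih =>
    simp only [checkVisibleLoop]
    split_ifs
    · simp [AdjMatrix.set_of_ne, h, h']
    · simp [AdjMatrix.set_of_ne, h, h']
    · exact ih _ _

/-- The loop of `checkVisible` finds the true entries, if the flags `fi`, `fj` are sound and the
pairs of sets that remain to be searched contain the witnesses that are still needed. -/
theorem agreeAt_checkVisibleLoop (hT : T.DecidesSupports α 𝓜) {i j : Fin p} (hij : i ≠ j)
    {A : AdjMatrix p} (hA : SoundAt 𝓜 A i j) (l : List (Finset (Fin p) × Finset (Fin p)))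
    (fi fj : Prop) (hl : ∀ q ∈ l, i ∉ q.1 ∧ j ∉ q.1 ∧ i ∉ q.2 ∧ j ∉ q.2)
    (hfi : fi → ¬ 𝓜.Invisible i j ∧ ¬ 𝓜.Edge (.inl i) (.inl j))
    (hfj : fj → ¬ 𝓜.Invisible i j ∧ ¬ 𝓜.Edge (.inl j) (.inl i))
    (hnon : 𝓜.VisibleNonEdge i j → ∃ q ∈ l, α < T.pval i q.1 j q.2)
    (hji : 𝓜.VisibleEdge j i → fi ∨ ∃ q ∈ l, α < T.pval i (insert j q.1) j q.2)
    (hij' : 𝓜.VisibleEdge i j → fj ∨ ∃ q ∈ l, α < T.pval i q.1 j (insert i q.2)) :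
    AgreeAt 𝓜.trueEntry (checkVisibleLoop T α i j A l fi fj) i j := by
  have zeros : ∀ A : AdjMatrix p, ¬ 𝓜.Invisible i j → ¬ 𝓜.Edge (.inl i) (.inl j) →
      ¬ 𝓜.Edge (.inl j) (.inl i) →
      AgreeAt 𝓜.trueEntry ((A.set i j .zero).set j i .zero) i j := by
    intro A h1 h2 h3
    rw [AgreeAt, Model.trueEntry_eq_zero.2 ⟨h3, h1⟩,
      Model.trueEntry_eq_zero.2 ⟨h2, fun h => h1 h.symm⟩]
    simp [AdjMatrix.set]
  induction l generalizing fi fj with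
  | nil =>
    simp only [List.not_mem_nil, false_and, exists_false, or_false, imp_false] at hnon hji hij'
    simp only [checkVisibleLoop]
    by_cases hinv : 𝓜.Invisible i j
    · rw [if_neg fun h => (hfj h).1 hinv, if_neg fun h => (hfi h).1 hinv]
      rcases hA with hA | hA
      · exact hA
      · exact ⟨by rw [hA.1, Model.trueEntry_eq_nan.2 hinv],
          by rw [hA.2, Model.trueEntry_eq_nan.2 hinv.symm]⟩
    have hinv' : ¬ 𝓜.Invisible j i := fun h => hinv h.symm
    by_cases h1 : 𝓜.Edge (.inl j) (.inl i)
    · have h2 : ¬ 𝓜.Edge (.inl i) (.inl j) := fun h => 𝓜.not_anc_of_edge h1 (.single h)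
      rw [if_neg fun h => (hfj h).2 h1, if_pos (hji ⟨h1, hinv⟩), AgreeAt,
        Model.trueEntry_eq_one.2 ⟨h1, hinv⟩, Model.trueEntry_eq_zero.2 ⟨h2, hinv'⟩]
      simp [AdjMatrix.set, hij]
    by_cases h2 : 𝓜.Edge (.inl i) (.inl j)
    · rw [if_pos (hij' ⟨h2, hinv'⟩), AgreeAt, Model.trueEntry_eq_zero.2 ⟨h1, hinv⟩,
        Model.trueEntry_eq_one.2 ⟨h2, hinv'⟩]
      simp [AdjMatrix.set, hij.symm]
    · exact absurd ⟨h2, h1, hinv⟩ hnon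
  | cons q l ih =>
    obtain ⟨M, N⟩ := q
    obtain ⟨hiM, hjM, hiN, hjN⟩ := hl (M, N) List.mem_cons_self
    dsimp only at hiM hjM hiN hjN
    have hpi : α < T.pval i (insert j M) j N →
        ¬ 𝓜.Invisible i j ∧ ¬ 𝓜.Edge (.inl i) (.inl j) := fun h => by
      have h' := (hT hij (by simp [hij, hiM]) hjN).1 h
      exact ⟨Model.not_invisible_of_disjoint h', Model.not_edge_of_disjoint h' hiN⟩
    have hpj : α < T.pval i M j (insert i N) →
        ¬ 𝓜.Invisible i j ∧ ¬ 𝓜.Edge (.inl j) (.inl i) := fun h => by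
      have h' := (hT hij hiM (by simp [hij.symm, hjN])).1 h
      exact ⟨Model.not_invisible_of_disjoint h', Model.not_edge_of_disjoint h'.symm hjM⟩
    simp only [checkVisibleLoop]
    split_ifs with h1 h2
    · have h' := (hT hij hiM hjN).1 h1
      exact zeros A (Model.not_invisible_of_disjoint h') (Model.not_edge_of_disjoint h' hiN)
        (Model.not_edge_of_disjoint h'.symm hjM)
    · have hi := h2.1.elim hfi hpi
      have hj := h2.2.elim hfj hpj
      exact zeros A hi.1 hi.2 hj.2
    · refine ih _ _ (fun q hq => hl q (List.mem_cons_of_mem _ hq)) (fun h => h.elim hfi hpi)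
        (fun h => h.elim hfj hpj) ?_ ?_ ?_
      · intro h
        obtain ⟨q, hq, hlt⟩ := hnon h
        rcases List.mem_cons.1 hq with rfl | hq
        · exact absurd hlt h1
        · exact ⟨q, hq, hlt⟩
      · intro h
        rcases hji h with h | ⟨q, hq, hlt⟩
        · exact Or.inl (Or.inl h)
        · rcases List.mem_cons.1 hq with rfl | hq
          · exact Or.inl (Or.inr hlt)
          · exact Or.inr ⟨q, hq, hlt⟩
      · intro h
        rcases hij' h with h | ⟨q, hq, hlt⟩
        · exact Or.inl (Or.inl h)
        · rcases List.mem_cons.1 hq with rfl | hq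
          · exact Or.inl (Or.inr hlt)
          · exact Or.inr ⟨q, hq, hlt⟩

/-- As long as the entries are sound, the search set contains all other observed parents of the two
variables, and regressing on these separates the residuals of a visible pair. -/
theorem agreeAt_checkVisible (hT : T.DecidesSupports α 𝓜) {A : AdjMatrix p}
    (hA : ∀ a b, a ≠ b → SoundAt 𝓜 A a b) {i j : Fin p} (hij : i ≠ j) :
    AgreeAt 𝓜.trueEntry (checkVisible T α o A (i, j)) i j := by
  classical
  have hentry : ∀ k l : Fin p, 𝓜.Edge (.inl k) (.inl l) → A l k = .nan ∨ A l k = .one := by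
    intro k l hkl
    have hne : l ≠ k := by
      rintro rfl
      exact 𝓜.not_anc_of_edge hkl .refl
    rcases hA l k hne with h | h
    · rw [h.1]
      by_cases hinv : 𝓜.Invisible l k
      · exact Or.inl (Model.trueEntry_eq_nan.2 hinv)
      · exact Or.inr (Model.trueEntry_eq_one.2 ⟨hkl, hinv⟩)
    · exact Or.inl h.1
  have hQ : ∀ k, k ≠ i → k ≠ j → 𝓜.Edge (.inl k) (.inl i) ∨ 𝓜.Edge (.inl k) (.inl j) →
      k ∈ searchSet A i j := by
    intro k hki hkj hk
    have := hk.imp (hentry k i) (hentry k j)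
    simp only [searchSet, Finset.mem_filter_univ]
    tauto
  have hmem : ∀ q : Finset (Fin p) × Finset (Fin p),
      q ∈ o.subsets (searchSet A i j) ×ˢ o.subsets (searchSet A i j) ↔
        q.1 ⊆ searchSet A i j ∧ q.2 ⊆ searchSet A i j := by
    rintro ⟨M, N⟩
    exact List.pair_mem_product.trans (and_congr (o.mem_subsets _ _) (o.mem_subsets _ _))
  have hQi : i ∉ searchSet A i j := by simp [searchSet]
  have hQj : j ∉ searchSet A i j := by simp [searchSet]
  have hfull : (searchSet A i j, searchSet A i j) ∈
      o.subsets (searchSet A i j) ×ˢ o.subsets (searchSet A i j) :=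
    (hmem _).2 ⟨Finset.Subset.refl _, Finset.Subset.refl _⟩
  have hirr : ∀ {k l : Fin p}, 𝓜.Edge (.inl k) (.inl l) → k ≠ l := by
    rintro k _ h rfl
    exact 𝓜.not_anc_of_edge h .refl
  unfold checkVisible
  refine agreeAt_checkVisibleLoop hT hij (hA i j hij) _ False False ?_ False.elim False.elim
    ?_ ?_ ?_
  · intro q hq
    obtain ⟨h1, h2⟩ := (hmem q).1 hq
    exact ⟨fun h => hQi (h1 h), fun h => hQj (h1 h), fun h => hQi (h2 h), fun h => hQj (h2 h)⟩
  · rintro ⟨h1, h2, hinv⟩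
    refine ⟨_, hfull, (hT hij hQi hQj).2 (Model.disjoint_of_not_invisible hij hinv ?_ ?_)⟩
    · intro m hm
      exact hQ m (hirr hm) (fun h => h2 (h ▸ hm)) (Or.inl hm)
    · intro m hm
      exact hQ m (fun h => h1 (h ▸ hm)) (hirr hm) (Or.inr hm)
  · rintro ⟨h1, hinv⟩
    refine Or.inr ⟨_, hfull, (hT hij (by simp [hij, hQi]) hQj).2
      (Model.disjoint_of_not_invisible hij hinv ?_ ?_)⟩
    · intro m hm
      by_cases hmj : m = j
      · exact Finset.mem_insert.2 (Or.inl hmj)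
      · exact Finset.mem_insert_of_mem (hQ m (hirr hm) hmj (Or.inl hm))
    · intro m hm
      refine hQ m (fun h => ?_) (hirr hm) (Or.inr hm)
      exact 𝓜.not_anc_of_edge h1 (.single (h ▸ hm))
  · rintro ⟨h1, hinv⟩
    refine Or.inr ⟨_, hfull, (hT hij hQi (by simp [hij.symm, hQj])).2
      (Model.disjoint_of_not_invisible hij (fun h => hinv h.symm) ?_ ?_)⟩
    · intro m hm
      refine hQ m (hirr hm) (fun h => ?_) (Or.inl hm)
      exact 𝓜.not_anc_of_edge h1 (.single (h ▸ hm))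
    · intro m hm
      by_cases hmi : m = i
      · exact Finset.mem_insert.2 (Or.inl hmi)
      · exact Finset.mem_insert_of_mem (hQ m hmi (hirr hm) (Or.inr hm))

theorem visibility_eq_trueEntry (hT : T.DecidesSupports α 𝓜) (d : ℕ) {a b : Fin p} (hab : a ≠ b) :
    visibility T α o d a b = 𝓜.trueEntry a b := by
  classical
  have hstart : ∀ a b, a ≠ b → SoundAt 𝓜 (camUV T α o d) a b := fun a b => soundAt_camUV hT d
  have hkeep : ∀ (A : AdjMatrix p) (i j a b : Fin p),
      (checkVisible T α o A (i, j) a b = A a b ∧ checkVisible T α o A (i, j) b a = A b a) ∨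
      (a = i ∧ b = j) ∨ (a = j ∧ b = i) := by
    intro A i j a b
    by_cases h1 : a = i ∧ b = j
    · exact Or.inr (Or.inl h1)
    by_cases h2 : a = j ∧ b = i
    · exact Or.inr (Or.inr h2)
    exact Or.inl ⟨checkVisibleLoop_of_ne h1 h2 _ _ _ _,
      checkVisibleLoop_of_ne (fun h => h2 h.symm) (fun h => h1 h.symm) _ _ _ _⟩
  have hagree : ∀ A : AdjMatrix p, (∀ a b, a ≠ b → SoundAt 𝓜 A a b) → ∀ q ∈ o.pairsLT,
      ∀ a b, AgreeAt 𝓜.trueEntry A a b →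
        AgreeAt 𝓜.trueEntry (checkVisible T α o A q) a b := by
    rintro A hA ⟨i, j⟩ hq a b h
    have hnew := agreeAt_checkVisible (o := o) hT hA ((o.mem_pairsLT _).1 hq).ne
    rcases hkeep A i j a b with h' | ⟨rfl, rfl⟩ | ⟨rfl, rfl⟩
    · unfold AgreeAt
      rwa [h'.1, h'.2]
    · exact hnew
    · exact hnew.symm
  let l := o.pairsLT.filter fun q => camUV T α o d q.1 q.2 = .nan ∧ camUV T α o d q.2 q.1 = .nan
  have hl : ∀ q ∈ l, q ∈ o.pairsLT := fun q hq => List.mem_of_mem_filter hq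
  -- The pairs that CAM-UV has already settled stay settled: the second half of the invariant.
  have h := foldl_invariant (f := checkVisible T α o) (l := l)
    (P := fun A => (∀ a b, a ≠ b → SoundAt 𝓜 A a b) ∧
      ∀ a b, AgreeAt 𝓜.trueEntry (camUV T α o d) a b → AgreeAt 𝓜.trueEntry A a b)
    (R := fun q A => AgreeAt 𝓜.trueEntry A q.1 q.2)
    (fun A hA q hq => ⟨⟨fun a b hab => ?_, fun a b h => hagree A hA.1 q (hl q hq) a b (hA.2 a b h)⟩,
      agreeAt_checkVisible hT hA.1 ((o.mem_pairsLT _).1 (hl q hq)).ne⟩)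
    (fun A hA q hq q' hq' => hagree A hA.1 q (hl q hq) _ _ hq')
    (camUV T α o d) ⟨hstart, fun _ _ h => h⟩
  · have hlt : ∀ {a b : Fin p}, a < b → AgreeAt 𝓜.trueEntry (visibility T α o d) a b := by
      intro a b hab
      rcases hstart a b hab.ne with h' | h'
      · exact h.1.2 a b h'
      · exact h.2 (a, b) (List.mem_filter.2 ⟨(o.mem_pairsLT _).2 hab, by simpa using h'⟩)
    rcases lt_or_gt_of_ne hab with hab | hab
    · exact (hlt hab).1
    · exact (hlt hab).2
  · rcases hA.1 a b hab with h | h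
    · exact Or.inl (hagree A hA.1 q (hl q hq) a b h)
    · obtain ⟨i, j⟩ := q
      have hnew := agreeAt_checkVisible (o := o) hT hA.1 ((o.mem_pairsLT _).1 (hl _ hq)).ne
      rcases hkeep A i j a b with h' | ⟨rfl, rfl⟩ | ⟨rfl, rfl⟩
      · exact Or.inr (by rwa [h'.1, h'.2])
      · exact Or.inl hnew
      · exact Or.inl hnew.symm

end Visibility

/-! ### The remaining procedures -/

section Refinement

variable {n p : ℕ} {U Ω : Type*} [Fintype U] [MeasurableSpace Ω] {μ : Measure Ω}
  {𝓜 : Model p U μ} {T : Tests n p} {α : ℝ} {o : LoopOrder p}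

/-- The entries of all visible pairs are the true ones. -/
def TrueOnVisible (𝓜 : Model p U μ) (A : AdjMatrix p) : Prop :=
  ∀ a b, a ≠ b → ¬ 𝓜.Invisible a b → A a b = 𝓜.trueEntry a b

theorem TrueOnVisible.invisible_of_eq_nan {A : AdjMatrix p} (hA : TrueOnVisible 𝓜 A) {a b : Fin p}
    (hab : a ≠ b) (h : A a b = .nan) : 𝓜.Invisible a b := by
  by_contra hinv
  exact hinv (Model.trueEntry_eq_nan.1 ((hA a b hab hinv).symm.trans h))

theorem TrueOnVisible.set {A : AdjMatrix p} (hA : TrueOnVisible 𝓜 A) {i j : Fin p} {x : Entry}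
    (hx : i ≠ j → ¬ 𝓜.Invisible i j → x = 𝓜.trueEntry i j) : TrueOnVisible 𝓜 (A.set i j x) := by
  intro a b hab hinv
  by_cases h : a = i ∧ b = j
  · obtain ⟨rfl, rfl⟩ := h
    rw [AdjMatrix.set_self, hx hab hinv]
  · rw [AdjMatrix.set_of_ne _ _ h, hA a b hab hinv]

theorem zero_eq_trueEntry_of_anc {i k : Fin p} (hik : Anc 𝓜.Edge (.inl k) (.inl i))
    (hinv : ¬ 𝓜.Invisible k i) : Entry.zero = 𝓜.trueEntry k i :=
  (Model.trueEntry_eq_zero.2 ⟨fun he => 𝓜.not_anc_of_edge he hik, hinv⟩).symm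

/-- If the residuals of a visible pair are dependent for all regression sets without `x_k`, then
`x_k` is a parent of one of the two. -/
theorem edge_or_edge_of_forall_not_lt_pval (hT : T.DecidesSupports α 𝓜) {i j k : Fin p}
    (hij : i ≠ j) (hinv : ¬ 𝓜.Invisible i j)
    (h : ∀ M N : Finset (Fin p), i ∉ M → k ∉ M → j ∉ N → k ∉ N → ¬ α < T.pval i M j N) :
    𝓜.Edge (.inl k) (.inl i) ∨ 𝓜.Edge (.inl k) (.inl j) := by
  classical
  by_contra hk
  rw [not_or] at hk
  have hirr : ∀ l : Fin p, ¬ 𝓜.Edge (.inl l) (.inl l) := fun l hl => 𝓜.not_anc_of_edge hl .refl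
  let P : Fin p → Finset (Fin p) := fun l => {m | 𝓜.Edge (.inl m) (.inl l)}
  have hP : ∀ l m, m ∈ P l ↔ 𝓜.Edge (.inl m) (.inl l) := by simp [P]
  have h1 : i ∉ P i := by rw [hP]; exact hirr i
  have h2 : j ∉ P j := by rw [hP]; exact hirr j
  exact h (P i) (P j) h1 (by rw [hP]; exact hk.1) h2 (by rw [hP]; exact hk.2)
    ((hT hij h1 h2).2 (Model.disjoint_of_not_invisible hij hinv (fun m => (hP i m).2)
      fun m => (hP j m).2))

/-- `checkOnPath` writes `zero` at `(k, i)` if `x_j → x_i`, and at `(k, j)` if `x_i → x_j`. Both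
alternatives of `edge_or_edge_of_forall_not_lt_pval` then make `x_k` an ancestor of the child, so
that `zero` is the true entry if the pair is visible. -/
theorem trueOnVisible_checkOnPathStep (hT : T.DecidesSupports α 𝓜) {i j : Fin p} (hij : i ≠ j)
    (hinv : ¬ 𝓜.Invisible i j) {s : State p} (hs : TrueOnVisible 𝓜 s.A) (k : Fin p) :
    TrueOnVisible 𝓜 (checkOnPathStep T α i j s k).A := by
  unfold checkOnPathStep
  dsimp only
  split_ifs with h h1 h2
  · have hji : 𝓜.Edge (.inl j) (.inl i) :=
      (Model.trueEntry_eq_one.1 ((hs i j hij hinv).symm.trans h1)).1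
    refine hs.set fun _ => zero_eq_trueEntry_of_anc ?_
    rcases edge_or_edge_of_forall_not_lt_pval hT hij hinv h.2.2.2 with he | he
    · exact .single he
    · exact .tail (.single he) hji
  · have hij' : 𝓜.Edge (.inl i) (.inl j) := (Model.trueEntry_eq_one.1
      ((hs j i hij.symm fun h => hinv h.symm).symm.trans h2)).1
    refine hs.set fun _ => zero_eq_trueEntry_of_anc ?_
    rcases edge_or_edge_of_forall_not_lt_pval hT hij hinv h.2.2.2 with he | he
    · exact .tail (.single he) hij'
    · exact .single he
  · exact hs
  · exact hs

theorem trueOnVisible_checkCIStep {i j : Fin p} (hinv : i ≠ j → 𝓜.Invisible i j) {s : State p}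
    (hs : TrueOnVisible 𝓜 s.A) (k : Fin p) : TrueOnVisible 𝓜 (checkCIStep T α i j s k).A := by
  unfold checkCIStep
  split_ifs
  · exact hs.set fun hij h => absurd (hinv hij) h
  · exact hs

theorem trueOnVisible_checkParentInviStep {s : State p} (hs : TrueOnVisible 𝓜 s.A) (k : Fin p)
    (q : Fin p × Fin p) : TrueOnVisible 𝓜 (checkParentInviStep k s q).A := by
  unfold checkParentInviStep
  split_ifs with h
  · refine (hs.set fun hne hinv => ?_).set fun hne hinv => ?_
    · exact absurd (hs.invisible_of_eq_nan hne h.2.1) hinv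
    · exact absurd (hs.invisible_of_eq_nan hne.symm h.2.1).symm hinv
  · exact hs

theorem trueOnVisible_foldl {ι : Type*} {f : State p → ι → State p} (l : List ι)
    (hf : ∀ s, TrueOnVisible 𝓜 s.A → ∀ q ∈ l, TrueOnVisible 𝓜 (f s q).A) {s : State p}
    (hs : TrueOnVisible 𝓜 s.A) : TrueOnVisible 𝓜 (l.foldl f s).A :=
  (foldl_invariant (P := fun s : State p => TrueOnVisible 𝓜 s.A) (R := fun _ _ => True)
    (fun s hs q hq => ⟨hf s hs q hq, trivial⟩) (fun _ _ _ _ _ _ => trivial) s hs).1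

theorem trueOnVisible_checkParentInvi {s : State p} (hs : TrueOnVisible 𝓜 s.A) :
    TrueOnVisible 𝓜 (checkParentInvi o s).A := by
  unfold checkParentInvi
  generalize p * p + 1 = m
  induction m with
  | zero => exact hs
  | succ m ih =>
    rw [Function.iterate_succ_apply']
    exact trueOnVisible_foldl _ (fun s hs k _ => trueOnVisible_foldl _
      (fun s hs q _ => trueOnVisible_checkParentInviStep hs k q) hs) ih

theorem trueOnVisible_camUVX (hT : T.DecidesSupports α 𝓜) (d : ℕ) :
    TrueOnVisible 𝓜 (camUVX T α o d).A := by
  have hvis : TrueOnVisible 𝓜 (visibility T α o d) :=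
    fun a b hab _ => visibility_eq_trueEntry hT d hab
  have hpath := trueOnVisible_foldl (𝓜 := 𝓜) (f := checkOnPath T α o)
    (s := ⟨visibility T α o d, fun _ => ∅, fun _ => ∅, fun _ => ∅⟩) (o.pairsLT.filter fun q =>
      visibility T α o d q.1 q.2 ≠ .nan ∧ visibility T α o d q.2 q.1 ≠ .nan) (fun s hs q hq => ?_)
    hvis
  · refine trueOnVisible_checkParentInvi (trueOnVisible_foldl _ (fun s hs q hq => ?_) hpath)
    have hnan := List.of_mem_filter hq
    simp only [decide_eq_true_eq] at hnan
    exact trueOnVisible_foldl _ (fun s hs k _ => trueOnVisible_checkCIStep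
      (fun hne => hpath.invisible_of_eq_nan hne hnan.1) hs k) hs
  · obtain ⟨hq, hnan⟩ := List.mem_filter.1 hq
    simp only [decide_eq_true_eq] at hnan
    have hne := ((o.mem_pairsLT q).1 hq).ne
    refine trueOnVisible_foldl _ (fun s hs k _ => trueOnVisible_checkOnPathStep hT hne ?_ hs k) hs
    rw [← Model.trueEntry_eq_nan, ← visibility_eq_trueEntry (o := o) hT d hne]
    exact hnan.1

end Refinement

end CAMUV

theorem theorem1 {n p : ℕ} {U Ω : Type*} [Fintype U] [MeasurableSpace Ω] [StandardBorelSpace Ω]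
    (μ : MeasureTheory.Measure Ω) [MeasureTheory.IsProbabilityMeasure μ]
    (𝓜 : CAMUV.Model p U μ)
    (𝒢 : Set (Fin p → ℝ → ℝ)) (h_meas : ∀ G ∈ 𝒢, ∀ m, Measurable (G m))
    (h_true : ∀ i : Fin p, (fun m => 𝓜.f (Sum.inl i) (Sum.inl m)) ∈ 𝒢)
    (h_faithful : 𝓜.Faithful)
    (h_class : 𝓜.NoCancellation 𝒢)
    (T : CAMUV.Tests n p) (α : ℝ) (h_tests : T.Correct α 𝓜 𝒢)
    (d : ℕ) (o : CAMUV.LoopOrder p) (i j : Fin p) (hij : i ≠ j) :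
    ((CAMUV.camUVX T α o d).IdentifiesEdge j i ↔ 𝓜.VisibleEdge j i) ∧
    ((CAMUV.camUVX T α o d).IdentifiesNonEdge i j ↔ 𝓜.VisibleNonEdge i j) ∧
    ((CAMUV.camUVX T α o d).IdentifiesInvisible i j ↔ 𝓜.Invisible i j) ∧
    (¬ 𝓜.Invisible i j →
      (CAMUV.camUVX T α o d).A i j = (CAMUV.camUVX T α o d).vis i j) := by
  have hT : T.DecidesSupports α 𝓜 := fun i j hij M N hM hN =>
    h_tests.lt_pval_iff h_true h_faithful h_class hij hM hN
  have hvis : ∀ {a b : Fin p}, a ≠ b → (CAMUV.camUVX T α o d).vis a b = 𝓜.trueEntry a b :=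
    fun hab => CAMUV.visibility_eq_trueEntry hT d hab
  have hsymm : 𝓜.Invisible j i ↔ 𝓜.Invisible i j :=
    ⟨CAMUV.Model.Invisible.symm, CAMUV.Model.Invisible.symm⟩
  refine ⟨?_, ?_, ?_, fun hinv => ?_⟩
  · rw [CAMUV.Output.IdentifiesEdge, hvis hij, hvis hij.symm, CAMUV.Model.trueEntry_eq_one,
      CAMUV.Model.trueEntry_eq_zero, hsymm]
    exact ⟨And.left, fun h => ⟨h, fun he => 𝓜.not_anc_of_edge h.1 (.single he), h.2⟩⟩
  · rw [CAMUV.Output.IdentifiesNonEdge, hvis hij, hvis hij.symm, CAMUV.Model.trueEntry_eq_zero,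
      CAMUV.Model.trueEntry_eq_zero, hsymm]
    exact ⟨fun h => ⟨h.2.1, h.1.1, h.1.2⟩, fun h => ⟨⟨h.2.1, h.2.2⟩, h.1, h.2.2⟩⟩
  · rw [CAMUV.Output.IdentifiesInvisible, hvis hij, hvis hij.symm, CAMUV.Model.trueEntry_eq_nan,
      CAMUV.Model.trueEntry_eq_nan, hsymm, and_self]
  · rw [hvis hij, CAMUV.trueOnVisible_camUVX hT d i j hij hinv]
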